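/- Let $n\ge 2$, let $\Delta\subset\mathbb R^n$ be a finite simplicial complex that is pure (all maximal faces have dimension $n$) and hereditary (whenever two $n$-faces $\sigma,\sigma'$ meet in a nonempty face $\beta$, there is a chain of $n$-faces $\sigma=\sigma_0,\dots,\sigma_m=\sigma'$, all containing $\beta$, with each $\sigma_{j-1}\cap\sigma_j$ an interior $(n-1)$-face). Write $\Delta_j$ for the set of $j$-faces and $\Delta_{n-1}^\circ$ for the set of interior $(n-1)$-faces, i.e. those shared by two distinct $n$-faces. Fix $0\le i\le n-2$ and integers $r_\tau\ge 0$ $(\tau\in\Delta_{n-1}^\circ)$, $s_\beta\ge 0$ $(\beta\in\Delta_i)$. Let $\mathtt R=\mathbb R[x_1,\dots,x_n]$ and $\mathtt S=\mathbb R[x_0,\dots,x_n]$. Let $\mathcal S^{\bm r,\bm s}(\Delta)$ be the set of continuous functions $f$ on (the underlying space of) $\Delta$ such that: $f|_\sigma$ is a polynomial for each $\sigma\in\Delta_n$; for each $\tau\in\Delta_{n-1}^\circ$, $f$ is $C^{r_\tau}$ on the star of $\tau$ (the union of the $n$-faces containing $\tau$); and for each $\beta\in\Delta_i$ the polynomials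 $f|_\sigma$, for all $\sigma\in\Delta_n$ with $\beta\subset\sigma$, have the same partial derivatives of all orders $\le s_\beta$ at all points of $\beta$. For $\tau\in\Delta_{n-1}^\circ$ let $\ell_\tau\in\mathtt S$ be any nonzero linear form vanishing on the cone $\hat\tau$, the convex hull of $0$ and $\{1\}\times\tau$ in $\mathbb R^{n+1}$, and let $\check\ell_\tau\in\mathtt R$ be $\ell_\tau$ with $x_0=1$. Let $\mathfrak m_\beta\subset\mathtt R$ be the ideal of polynomials vanishing on $\beta$, and $\hat{\mathfrak m}_\beta\subset\mathtt S$ the ideal generated by the homogenizations of its elements. Put $$\check{\mathtt J}(\tau)=\langle\check\ell_\tau^{\,r_\tau+1}\rangle\cap\bigcap_{\beta\in\Delta_i,\ \beta\subset\tau}\mathfrak m_\beta^{\,s_\beta+1},\qquad \mathtt J(\tau)=\langle\ell_\tau^{\,r_\tau+1}\rangle\cap\bigcap_{\beta\in\Delta_i,\ \beta\subset\tau}\hat{\mathfrak m}_\beta^{\,s_\beta+1}.$$ Theorem. Let $p=(p_\sigma)_{\sigma\in\Delta_n}$ be a family of polynomials in $\mathtt R$, let $d$ be any integer with $\deg p_\sigma\le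 d$ for all $\sigma$, and let $\hat p_\sigma=x_0^d\,p_\sigma(x_1/x_0,\dots,x_n/x_0)$ be the homogenization of $p_\sigma$ in degree $d$. The following are equivalent: 1. there is $f\in\mathcal S^{\bm r,\bm s}(\Delta)$ with $f|_\sigma=p_\sigma$ for all $\sigma\in\Delta_n$; 2. $\hat p_\sigma-\hat p_{\sigma'}\in\mathtt J(\tau)$ for all $\tau\in\Delta_{n-1}^\circ$ and $\sigma,\sigma'\in\Delta_n$ with $\sigma\cap\sigma'=\tau$; 3. $p_\sigma-p_{\sigma'}\in\check{\mathtt J}(\tau)$ for all $\tau\in\Delta_{n-1}^\circ$ and $\sigma,\sigma'\in\Delta_n$ with $\sigma\cap\sigma'=\tau$. In particular, for any piecewise polynomial function $f$ on $\Delta$ with pieces $f|_\sigma=p_\sigma$, the statement $f\in\mathcal S^{\bm r,\bm s}(\Delta)$ is equivalent to 2 and to 3. -/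

import Mathlib

open Geometry MvPolynomial

noncomputable section

/-- The `i`-dimensional faces (each face is recorded by its finite set of vertices). -/
def iFaces {n : ℕ} (Δ : SimplicialComplex ℝ (Fin n → ℝ)) (i : ℕ) : Set (Finset (Fin n → ℝ)) :=
  {β | β ∈ Δ.faces ∧ β.card = i + 1}

/-- The geometric simplex spanned by a finite set of vertices. -/
def simplex {n : ℕ} (β : Finset (Fin n → ℝ)) : Set (Fin n → ℝ) :=
  convexHull ℝ (β : Set (Fin n → ℝ))

/-- The interior faces of codimension one: the `(n-1)`-faces that do not lie on the boundary,
that is, that are shared by two different `n`-faces. -/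
def interiorWalls {n : ℕ} (Δ : SimplicialComplex ℝ (Fin n → ℝ)) : Set (Finset (Fin n → ℝ)) :=
  {τ | τ ∈ Δ.faces ∧ τ.card = n ∧
    ∃ σ ∈ iFaces Δ n, ∃ σ' ∈ iFaces Δ n, σ ≠ σ' ∧ τ ⊆ σ ∧ τ ⊆ σ'}

/-- Pure of full dimension: every maximal face has dimension `n`. -/
def IsPure {n : ℕ} (Δ : SimplicialComplex ℝ (Fin n → ℝ)) : Prop :=
  ∀ σ ∈ Δ.facets, σ.card = n + 1

/-- Hereditary: two `n`-faces meeting in a (nonempty) face `β` are joined by a chain of `n`-faces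
that contain `β`, in which consecutive members meet in an interior face of codimension one. -/
def IsHereditary {n : ℕ} (Δ : SimplicialComplex ℝ (Fin n → ℝ)) : Prop :=
  ∀ σ ∈ iFaces Δ n, ∀ σ' ∈ iFaces Δ n, ∀ β ∈ Δ.faces,
    (σ ∩ σ' : Set (Fin n → ℝ)) = β →
    ∃ (m : ℕ) (c : ℕ → Finset (Fin n → ℝ)), c 0 = σ ∧ c m = σ' ∧
      (∀ j ≤ m, c j ∈ iFaces Δ n ∧ β ⊆ c j) ∧
      ∀ j < m, ∃ τ ∈ interiorWalls Δ, (c j ∩ c (j + 1) : Set (Fin n → ℝ)) = τ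

/-- The (closed) star of `β`: all simplices having `β` as a face, together with their faces. -/
def faceStar {n : ℕ} (Δ : SimplicialComplex ℝ (Fin n → ℝ)) (β : Finset (Fin n → ℝ)) :
    SimplicialComplex ℝ (Fin n → ℝ) where
  faces := {t | t.Nonempty ∧ ∃ σ ∈ Δ.faces, β ⊆ σ ∧ t ⊆ σ}
  isRelLowerSet_faces := by
    rintro t ⟨ht, σ, hσ, hβ, hts⟩
    exact ⟨ht, fun u hu hne => ⟨hne, σ, hσ, hβ, fun x hx => hts (hu hx)⟩⟩
  indep := by
    rintro t ⟨ht, σ, hσ, hβ, hts⟩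
    exact Δ.indep (Δ.down_closed hσ hts ht)
  inter_subset_convexHull := by
    rintro t u ⟨ht, σ, hσ, hβ, hts⟩ ⟨hu, σ', hσ', hβ', hus⟩
    exact Δ.inter_subset_convexHull (Δ.down_closed hσ hts ht) (Δ.down_closed hσ' hus hu)

/-- The restriction of the function `f` to the simplex `σ` is given by the polynomial `p`. -/
def IsPiece {n : ℕ} (f : (Fin n → ℝ) → ℝ) (σ : Finset (Fin n → ℝ))
    (p : MvPolynomial (Fin n) ℝ) : Prop :=
  ∀ x ∈ simplex σ, f x = eval x p

/-- `C^r`-splines of degree at most `d` on `Δ`. Functions on the underlying space `Δ.space` are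
represented by functions on all of `ℝⁿ`, whose values outside `Δ.space` are irrelevant. -/
def splineSpace {n : ℕ} (Δ : SimplicialComplex ℝ (Fin n → ℝ)) (r d : ℕ) :
    Set ((Fin n → ℝ) → ℝ) :=
  {f | ContDiffOn ℝ r f Δ.space ∧
    ∀ σ ∈ iFaces Δ n, ∃ p : MvPolynomial (Fin n) ℝ, p.totalDegree ≤ d ∧ IsPiece f σ p}

/-- Splines of degree at most `d` with mixed smoothness `r`: continuous splines whose restriction
to the star of each interior face `τ` of codimension one is a `C^{r τ}`-spline. -/
def mixedSplineSpace {n : ℕ} (Δ : SimplicialComplex ℝ (Fin n → ℝ))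
    (r : Finset (Fin n → ℝ) → ℕ) (d : ℕ) : Set ((Fin n → ℝ) → ℝ) :=
  {f | f ∈ splineSpace Δ 0 d ∧ ∀ τ ∈ interiorWalls Δ, f ∈ splineSpace (faceStar Δ τ) (r τ) d}

/-- The iterated partial derivative of a polynomial in the listed coordinate directions. -/
def iterPDeriv {n : ℕ} (l : List (Fin n)) (p : MvPolynomial (Fin n) ℝ) :
    MvPolynomial (Fin n) ℝ :=
  l.foldr (fun j q => pderiv j q) p

/-- Supersmoothness `s` at the face `β`: the polynomial pieces of `f` on the `n`-faces containing
`β` have the same derivatives up to order `s` at all points of `β`. -/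
def IsSupersmoothAt {n : ℕ} (Δ : SimplicialComplex ℝ (Fin n → ℝ)) (f : (Fin n → ℝ) → ℝ)
    (β : Finset (Fin n → ℝ)) (s : ℕ) : Prop :=
  ∀ σ ∈ iFaces Δ n, ∀ σ' ∈ iFaces Δ n, β ⊆ σ → β ⊆ σ' →
    ∀ p p' : MvPolynomial (Fin n) ℝ, IsPiece f σ p → IsPiece f σ' p' →
      ∀ l : List (Fin n), l.length ≤ s →
        ∀ x ∈ simplex β, eval x (iterPDeriv l p) = eval x (iterPDeriv l p')

/-- Superspline space of degree at most `d`, with supersmoothness `s β` at each `i`-face `β`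
(boundary faces included). -/
def supersplineSpaceLE {n : ℕ} (Δ : SimplicialComplex ℝ (Fin n → ℝ)) (i : ℕ)
    (r s : Finset (Fin n → ℝ) → ℕ) (d : ℕ) : Set ((Fin n → ℝ) → ℝ) :=
  {f | f ∈ mixedSplineSpace Δ r d ∧ ∀ β ∈ iFaces Δ i, IsSupersmoothAt Δ f β (s β)}

/-- Superspline space: union over all degrees. -/
def supersplineSpace {n : ℕ} (Δ : SimplicialComplex ℝ (Fin n → ℝ)) (i : ℕ)
    (r s : Finset (Fin n → ℝ) → ℕ) : Set ((Fin n → ℝ) → ℝ) :=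
  ⋃ d : ℕ, supersplineSpaceLE Δ i r s d

/-- The point `(1, x)` of `ℝ^{n+1}`; coordinate `0` is the homogenizing one. -/
def coneEmbed {n : ℕ} (x : Fin n → ℝ) : Fin (n + 1) → ℝ := Fin.cons 1 x

/-- The cone over a simplex: the convex hull of the origin and of the simplex at height one. -/
def simplexCone {n : ℕ} (β : Finset (Fin n → ℝ)) : Set (Fin (n + 1) → ℝ) :=
  convexHull ℝ (insert 0 (coneEmbed '' simplex β))

/-- Homogenization of `p` in degree `d`, i.e. `x₀ ^ d * p (x / x₀)`
(meaningful when `p.totalDegree ≤ d`). -/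
def homogenizeIn {n : ℕ} (d : ℕ) (p : MvPolynomial (Fin n) ℝ) : MvPolynomial (Fin (n + 1)) ℝ :=
  ∑ α ∈ p.support, monomial (Finsupp.cons (d - α.degree) α) (p.coeff α)

/-- Homogenization of a polynomial, in its own degree. -/
def homogenization {n : ℕ} (p : MvPolynomial (Fin n) ℝ) : MvPolynomial (Fin (n + 1)) ℝ :=
  homogenizeIn p.totalDegree p

/-- Dehomogenization: substitute `1` for `x₀`. -/
def dehomogenize {n : ℕ} (q : MvPolynomial (Fin (n + 1)) ℝ) : MvPolynomial (Fin n) ℝ :=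
  aeval (Fin.cons 1 (fun j => X j) : Fin (n + 1) → MvPolynomial (Fin n) ℝ) q

/-- `ℓ` is a (nonzero) linear form vanishing on the cone over `τ`. -/
def IsWallForm {n : ℕ} (τ : Finset (Fin n → ℝ)) (ℓ : MvPolynomial (Fin (n + 1)) ℝ) : Prop :=
  ℓ.IsHomogeneous 1 ∧ ℓ ≠ 0 ∧ ∀ y ∈ simplexCone τ, eval y ℓ = 0

/-- The ideal `𝔪_β` of all polynomials vanishing on the simplex `β`. -/
def faceIdeal {n : ℕ} (β : Finset (Fin n → ℝ)) : Ideal (MvPolynomial (Fin n) ℝ) :=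
  vanishingIdeal ℝ (simplex β)

/-- The ideal generated by the homogenizations of the elements of `𝔪_β`. -/
def faceIdealHom {n : ℕ} (β : Finset (Fin n → ℝ)) : Ideal (MvPolynomial (Fin (n + 1)) ℝ) :=
  Ideal.span (homogenization '' (faceIdeal β : Set (MvPolynomial (Fin n) ℝ)))

/-- The affine ideal of the wall `τ`, for the linear form `ℓ` vanishing on the cone over `τ`. -/
def affineWallIdeal {n : ℕ} (Δ : SimplicialComplex ℝ (Fin n → ℝ)) (i : ℕ)
    (r s : Finset (Fin n → ℝ) → ℕ) (τ : Finset (Fin n → ℝ))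
    (ℓ : MvPolynomial (Fin (n + 1)) ℝ) : Ideal (MvPolynomial (Fin n) ℝ) :=
  Ideal.span {dehomogenize ℓ ^ (r τ + 1)} ⊓
    ⨅ β ∈ {β | β ∈ iFaces Δ i ∧ β ⊆ τ}, faceIdeal β ^ (s β + 1)

/-- The homogeneous ideal of the wall `τ`, for the linear form `ℓ` vanishing on the cone. -/
def wallIdeal {n : ℕ} (Δ : SimplicialComplex ℝ (Fin n → ℝ)) (i : ℕ)
    (r s : Finset (Fin n → ℝ) → ℕ) (τ : Finset (Fin n → ℝ))
    (ℓ : MvPolynomial (Fin (n + 1)) ℝ) : Ideal (MvPolynomial (Fin (n + 1)) ℝ) :=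
  Ideal.span {ℓ ^ (r τ + 1)} ⊓
    ⨅ β ∈ {β | β ∈ iFaces Δ i ∧ β ⊆ τ}, faceIdealHom β ^ (s β + 1)

/-- The affine criterion for a family `p` of polynomials indexed by the `n`-faces. -/
def AffineCriterion {n : ℕ} (Δ : SimplicialComplex ℝ (Fin n → ℝ)) (i : ℕ)
    (r s : Finset (Fin n → ℝ) → ℕ) (ℓ : Finset (Fin n → ℝ) → MvPolynomial (Fin (n + 1)) ℝ)
    (p : Finset (Fin n → ℝ) → MvPolynomial (Fin n) ℝ) : Prop :=
  ∀ τ ∈ interiorWalls Δ, ∀ σ ∈ iFaces Δ n, ∀ σ' ∈ iFaces Δ n,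
    (σ ∩ σ' : Set (Fin n → ℝ)) = τ →
      p σ - p σ' ∈ affineWallIdeal Δ i r s τ (ℓ τ)

/-- The homogeneous criterion; all pieces are homogenized in the same degree `d`. -/
def HomogeneousCriterion {n : ℕ} (Δ : SimplicialComplex ℝ (Fin n → ℝ)) (i : ℕ)
    (r s : Finset (Fin n → ℝ) → ℕ) (ℓ : Finset (Fin n → ℝ) → MvPolynomial (Fin (n + 1)) ℝ)
    (d : ℕ) (p : Finset (Fin n → ℝ) → MvPolynomial (Fin n) ℝ) : Prop :=
  ∀ τ ∈ interiorWalls Δ, ∀ σ ∈ iFaces Δ n, ∀ σ' ∈ iFaces Δ n,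
    (σ ∩ σ' : Set (Fin n → ℝ)) = τ →
      homogenizeIn d (p σ) - homogenizeIn d (p σ') ∈ wallIdeal Δ i r s τ (ℓ τ)

end

/-! The equivalences are proved as a cycle: spline, homogeneous criterion, affine criterion, spline.

From a spline to the homogeneous criterion, smoothness across a wall `τ` or supersmoothness at `β`
says that the difference `q` of two pieces has vanishing derivatives up to some order `s` on that
face. This must become membership of the homogenization in the `(s+1)`-st power of an ideal, which
is `homogenizeIn_mem_pow`. Project affinely onto the span of the face and insert a parameter `T`
that scales the displacement from the projection. The linear forms measuring this displacement
vanish on the cone and so lie in the ideal `I`; hence the coefficient of `T ^ k` lies in `I ^ k`.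
The vanishing derivatives kill the coefficients with `k ≤ s`, and `T = 1` returns the
homogenization. The same lemma serves walls and `i`-faces, with different `I`.

Setting `x₀ = 1` sends the homogeneous ideals into the affine ones.

From the affine criterion to a spline, values and derivatives agree across each wall, and the
hereditary chains carry the agreement to all `n`-faces around a given face
(`IsHereditary.eq_of_walls`). So the pieces glue and are supersmooth. A wall has exactly one
`n`-face on each side (`eq_of_same_side`), so on its star the function is a polynomial plus a
polynomial multiple of the truncated power `max (ℓ, 0) ^ (r + 1)`, which is of class `C^r`. -/

/-! ### Restricting polynomials to lines -/

/-- The univariate polynomial `t ↦ q (x + t w)`. -/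
noncomputable def restrictLine {n : ℕ} (x w : Fin n → ℝ) :
    MvPolynomial (Fin n) ℝ →ₐ[ℝ] Polynomial ℝ :=
  aeval fun j => Polynomial.C (x j) + Polynomial.X * Polynomial.C (w j)

theorem eval_restrictLine {n : ℕ} (x w : Fin n → ℝ) (q : MvPolynomial (Fin n) ℝ) (t : ℝ) :
    (restrictLine x w q).eval t = eval (fun j => x j + t * w j) q := by
  induction q using MvPolynomial.induction_on with
  | C a => simp [restrictLine]
  | add p q hp hq => simp [hp, hq]
  | mul_X p j hp => 
    rw [map_mul, Polynomial.eval_mul, hp, map_mul, restrictLine, aeval_X]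
    simp only [Polynomial.eval_add, Polynomial.eval_mul, Polynomial.eval_C, Polynomial.eval_X,
      eval_X]

theorem derivative_restrictLine {n : ℕ} (x w : Fin n → ℝ) (q : MvPolynomial (Fin n) ℝ) :
    (restrictLine x w q).derivative =
      ∑ j, Polynomial.C (w j) * restrictLine x w (pderiv j q) := by
  induction q using MvPolynomial.induction_on with
  | C a => simp [restrictLine]
  | add p q hp hq => simp [hp, hq, mul_add, Finset.sum_add_distrib]
  | mul_X p k hp =>
    have h1 : ∀ j, Polynomial.C (w j) * restrictLine x w (pderiv j (p * X k)) =
        (Polynomial.C (w j) * restrictLine x w (pderiv j p)) * restrictLine x w (X k) +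
        (if j = k then restrictLine x w p * Polynomial.C (w j) else 0) := by
      intro j
      rw [pderiv_mul, pderiv_X]
      by_cases h : j = k
      · subst h; simp; ring
      · simp [h, Ne.symm h]; ring
    rw [map_mul, Polynomial.derivative_mul, hp, Finset.sum_congr rfl fun j _ => h1 j,
      Finset.sum_add_distrib, ← Finset.sum_mul, Finset.sum_ite_eq' Finset.univ k]
    simp [restrictLine]

theorem iterPDeriv_append_singleton {n : ℕ} (l : List (Fin n)) (j : Fin n)
    (q : MvPolynomial (Fin n) ℝ) : iterPDeriv (l ++ [j]) q = iterPDeriv l (pderiv j q) := by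
  simp [iterPDeriv]

theorem iterPDeriv_sub {n : ℕ} (l : List (Fin n)) (p q : MvPolynomial (Fin n) ℝ) :
    iterPDeriv l (p - q) = iterPDeriv l p - iterPDeriv l q := by
  induction l with
  | nil => rfl
  | cons j l ih => simpa [iterPDeriv] using congrArg (pderiv j) ih

/-- Characteristic zero enters here: coefficient `k` of the derivative is `k + 1` times coefficient
`k + 1` of `P`. -/
theorem X_pow_dvd_of_derivative {P : Polynomial ℝ} {s : ℕ} (h0 : P.eval 0 = 0)
    (h : Polynomial.X ^ s ∣ P.derivative) : Polynomial.X ^ (s + 1) ∣ P := by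
  rw [Polynomial.X_pow_dvd_iff] at h ⊢
  intro k hk
  cases k with
  | zero => rwa [Polynomial.coeff_zero_eq_eval_zero]
  | succ k =>
    have := h k (by omega)
    rw [Polynomial.coeff_derivative] at this
    have h2 : (k : ℝ) + 1 ≠ 0 := by positivity
    exact (mul_eq_zero.1 this).resolve_right h2

/-- By the chain rule the derivative along the line is a combination of restrictions of first
partials, whose hypothesis holds with `s` lowered by one. Since `iterPDeriv` is a right fold, the
direction differentiated first stands last in the list. -/
theorem X_pow_dvd_restrictLine {n : ℕ} (x w : Fin n → ℝ) (s : ℕ) (q : MvPolynomial (Fin n) ℝ)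
    (h : ∀ l : List (Fin n), l.length ≤ s → eval x (iterPDeriv l q) = 0) :
    Polynomial.X ^ (s + 1) ∣ restrictLine x w q := by
  induction s generalizing q with
  | zero =>
    refine X_pow_dvd_of_derivative ?_ (by simp)
    rw [eval_restrictLine]
    simpa [iterPDeriv] using h [] (by simp)
  | succ s ih =>
    refine X_pow_dvd_of_derivative ?_ ?_
    · rw [eval_restrictLine]
      simpa [iterPDeriv] using h [] (by simp)
    · rw [derivative_restrictLine]
      refine Finset.dvd_sum fun j _ => Dvd.dvd.mul_left (ih _ fun l hl => ?_) _
      rw [← iterPDeriv_append_singleton]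
      exact h _ (by simpa using hl)

/-! ### Zariski density of a simplex in its affine span -/

theorem exists_weights_of_mem_affineSpan {n : ℕ} {β : Finset (Fin n → ℝ)} {y : Fin n → ℝ}
    (hy : y ∈ affineSpan ℝ (β : Set (Fin n → ℝ))) :
    ∃ w : (Fin n → ℝ) → ℝ, ∑ v ∈ β, w v = 1 ∧ ∑ v ∈ β, w v • v = y := by
  have hy' : y ∈ affineSpan ℝ (Set.range ((↑) : β → Fin n → ℝ)) := by simpa using hy
  obtain ⟨w, hw, rfl⟩ := eq_affineCombination_of_mem_affineSpan_of_fintype hy'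
  classical
  refine ⟨fun v => if h : v ∈ β then w ⟨v, h⟩ else 0, ?_, ?_⟩
  · rw [← hw, ← Finset.sum_coe_sort β]
    simp
  · rw [Finset.affineCombination_eq_linear_combination _ _ _ hw, ← Finset.sum_coe_sort β]
    simp

/-- On the line from the barycentre of `β` towards `y`, the barycentric weights stay positive for
small `t > 0`. The restriction of `g` to this line has infinitely many roots, so it is zero, also at
`t = 1`. -/
theorem eval_eq_zero_of_mem_affineSpan {n : ℕ} {β : Finset (Fin n → ℝ)} (hβ : β.Nonempty)
    {g : MvPolynomial (Fin n) ℝ} (hg : ∀ x ∈ simplex β, eval x g = 0) {y : Fin n → ℝ}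
    (hy : y ∈ affineSpan ℝ (β : Set (Fin n → ℝ))) : eval y g = 0 := by
  obtain ⟨w, hw, rfl⟩ := exists_weights_of_mem_affineSpan hy
  have hk : (0 : ℝ) < β.card := by exact_mod_cast hβ.card_pos
  set a : ℝ := (β.card : ℝ)⁻¹ with ha
  have ha0 : 0 < a := inv_pos.2 hk
  set b : Fin n → ℝ := ∑ v ∈ β, a • v with hb
  set y : Fin n → ℝ := ∑ v ∈ β, w v • v with hyd
  set P := restrictLine b (y - b) g with hP
  have hsum : ∀ t : ℝ, ∑ v ∈ β, (a + t * (w v - a)) = 1 := by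
    intro t
    rw [Finset.sum_add_distrib, ← Finset.mul_sum, Finset.sum_sub_distrib, hw]
    have : ∑ _v ∈ β, a = 1 := by simp [ha, hk.ne']
    rw [this]; ring
  have hev : ∀ᶠ t in nhdsWithin (0 : ℝ) (Set.Ioi 0), P.IsRoot t := by
    have h1 : ∀ᶠ t in nhdsWithin (0 : ℝ) (Set.Ioi 0), ∀ v ∈ β, 0 < a + t * (w v - a) := by
      refine Filter.Eventually.filter_mono nhdsWithin_le_nhds ?_
      refine (Filter.eventually_all_finset β).2 fun v _ => ?_
      have : Continuous fun t : ℝ => a + t * (w v - a) := by fun_prop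
      exact this.continuousAt.eventually (lt_mem_nhds (by simpa using ha0))
    filter_upwards [h1] with t ht
    rw [Polynomial.IsRoot, hP, eval_restrictLine]
    apply hg
    have : (fun j => b j + t * (y - b) j) = ∑ v ∈ β, (a + t * (w v - a)) • v := by
      have : (fun j => b j + t * (y - b) j) = b + t • (y - b) := by ext; simp
      rw [this, hyd, hb, ← Finset.sum_sub_distrib, Finset.smul_sum, ← Finset.sum_add_distrib]
      refine Finset.sum_congr rfl fun v _ => ?_
      module
    rw [this]
    exact (convex_convexHull ℝ _).sum_mem (fun v hv => (ht v hv).le) (hsum t)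
      fun v hv => subset_convexHull ℝ _ hv
  have hP0 : P = 0 := by
    refine Polynomial.eq_zero_of_infinite_isRoot _ ?_
    obtain ⟨u, hu, hsub⟩ := mem_nhdsGT_iff_exists_Ioo_subset.1 hev
    exact (Set.Ioo_infinite hu).mono hsub
  have := eval_restrictLine b (y - b) g 1
  rw [← hP, hP0] at this
  simpa using this.symm

/-! ### Affine projections -/

/-- A linear left inverse of the inclusion of the direction space, recentred at a vertex, gives the
projection. Explicit coefficients are kept so that its displacement can be homogenized to linear
forms. -/
theorem exists_affine_projection {n : ℕ} {β : Finset (Fin n → ℝ)} (hβ : β.Nonempty) :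
    ∃ (c : Fin n → ℝ) (M : Fin n → Fin n → ℝ),
      (∀ x : Fin n → ℝ, (fun j => c j + ∑ k, M j k * x k) ∈
        affineSpan ℝ (β : Set (Fin n → ℝ))) ∧
      ∀ v ∈ β, ∀ j, c j + ∑ k, M j k * v k = v j := by
  obtain ⟨v₀, hv₀⟩ := hβ
  set W := vectorSpan ℝ (β : Set (Fin n → ℝ)) with hW
  obtain ⟨f, hf⟩ := W.subtype.exists_leftInverse_of_injective (by simp)
  set P : (Fin n → ℝ) →ₗ[ℝ] (Fin n → ℝ) := W.subtype ∘ₗ f with hP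
  have key : ∀ x j, v₀ j - P v₀ j + ∑ k, LinearMap.toMatrix' P j k * x k = (P (x - v₀) + v₀) j := by
    intro x j
    have : P x j = ∑ k, LinearMap.toMatrix' P j k * x k := by
      conv_lhs => rw [← Matrix.toLin'_toMatrix' P]
      rfl
    rw [← this, map_sub]
    simp; ring
  refine ⟨fun j => v₀ j - P v₀ j, fun j k => LinearMap.toMatrix' P j k, fun x => ?_, fun v hv j => ?_⟩
  · have : (fun j => v₀ j - P v₀ j + ∑ k, LinearMap.toMatrix' P j k * x k) =
        P (x - v₀) +ᵥ v₀ := by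
      ext j; exact key x j
    rw [this]
    refine AffineSubspace.vadd_mem_of_mem_direction ?_ (subset_affineSpan ℝ _ hv₀)
    rw [direction_affineSpan]
    exact (f (x - v₀)).2
  · rw [key]
    have hm : v - v₀ ∈ W := vsub_mem_vectorSpan ℝ hv hv₀
    have : f (v - v₀) = ⟨v - v₀, hm⟩ := LinearMap.congr_fun hf ⟨v - v₀, hm⟩
    simp [hP, this]

/-! ### Homogenization -/

theorem homogenizeIn_eq_sum {n : ℕ} (d : ℕ) (p : MvPolynomial (Fin n) ℝ)
    (S : Finset (Fin n →₀ ℕ)) (hS : p.support ⊆ S) :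
    homogenizeIn d p = ∑ α ∈ S, monomial (Finsupp.cons (d - α.degree) α) (p.coeff α) := by
  refine Finset.sum_subset hS fun α _ hα => ?_
  rw [notMem_support_iff.1 hα, monomial_zero]

theorem homogenizeIn_sub {n : ℕ} (d : ℕ) (p q : MvPolynomial (Fin n) ℝ) :
    homogenizeIn d (p - q) = homogenizeIn d p - homogenizeIn d q := by
  classical
  rw [homogenizeIn_eq_sum d (p - q) (p.support ∪ q.support) (support_sub _ p q),
    homogenizeIn_eq_sum d p (p.support ∪ q.support) Finset.subset_union_left,
    homogenizeIn_eq_sum d q (p.support ∪ q.support) Finset.subset_union_right,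
    ← Finset.sum_sub_distrib]
  exact Finset.sum_congr rfl fun α _ => by simp

/-- The algebra `A` is general because the identity is needed both for real points and for points
with coordinates in `Polynomial ℝ`. -/
theorem aeval_homogenizeIn {n : ℕ} {A : Type*} [CommRing A] [Algebra ℝ A] {d : ℕ}
    {q : MvPolynomial (Fin n) ℝ} (hq : q.totalDegree ≤ d) (a : A) (z : Fin n → A) :
    aeval (Fin.cons a (fun j => a * z j) : Fin (n + 1) → A) (homogenizeIn d q) =
      a ^ d * aeval z q := by
  rw [homogenizeIn, map_sum]
  conv_rhs => rw [q.as_sum, map_sum, Finset.mul_sum]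
  refine Finset.sum_congr rfl fun α hα => ?_
  have hd : α.degree ≤ d := (le_totalDegree hα).trans hq
  rw [aeval_monomial, aeval_monomial, Finsupp.prod_fintype _ _ (by simp),
    Finsupp.prod_fintype _ _ (by simp), Fin.prod_univ_succ]
  simp only [Finsupp.cons_zero, Finsupp.cons_succ, Fin.cons_zero, Fin.cons_succ, mul_pow,
    Finset.prod_mul_distrib, Finset.prod_pow_eq_pow_sum]
  have : a ^ d = a ^ (d - α.degree) * a ^ (∑ i, α i) := by
    rw [← Finsupp.degree_eq_sum, ← pow_add, Nat.sub_add_cancel hd]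
  rw [this]; ring

theorem dehomogenize_homogenizeIn {n : ℕ} (d : ℕ) (q : MvPolynomial (Fin n) ℝ) :
    dehomogenize (homogenizeIn d q) = q := by
  rw [dehomogenize, homogenizeIn, map_sum]
  conv_rhs => rw [q.as_sum]
  refine Finset.sum_congr rfl fun α hα => ?_
  rw [aeval_monomial, Finsupp.prod_fintype _ _ (by simp), Fin.prod_univ_succ, monomial_eq,
    Finsupp.prod_fintype _ _ (by simp)]
  simp

theorem homogenizeIn_eq_X_pow_mul {n : ℕ} {d : ℕ} {q : MvPolynomial (Fin n) ℝ}
    (hq : q.totalDegree ≤ d) :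
    homogenizeIn d q = X 0 ^ (d - q.totalDegree) * homogenization q := by
  rw [homogenization, homogenizeIn, homogenizeIn, Finset.mul_sum]
  refine Finset.sum_congr rfl fun α hα => ?_
  have h1 : α.degree ≤ q.totalDegree := le_totalDegree hα
  rw [X_pow_eq_monomial, monomial_mul, one_mul]
  have h2 : Finsupp.cons (d - α.degree) α =
      Finsupp.single 0 (d - q.totalDegree) + Finsupp.cons (q.totalDegree - α.degree) α := by
    ext j
    refine Fin.cases ?_ (fun j => ?_) j
    · simp; omega
    · simp
  rw [h2]

/-- The linear form with the given coefficients. -/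
noncomputable def linearForm {m : ℕ} (c : Fin m → ℝ) : MvPolynomial (Fin m) ℝ :=
  ∑ j, C (c j) * X j

theorem eval_linearForm {m : ℕ} (c y : Fin m → ℝ) :
    eval y (linearForm c) = ∑ j, c j * y j := by
  simp [linearForm]

theorem eval_one_aeval {σ : Type*} (u : σ → Polynomial (MvPolynomial σ ℝ))
    (hu : ∀ j, (u j).eval 1 = X j) (F : MvPolynomial σ ℝ) : (aeval u F).eval 1 = F := by
  induction F using MvPolynomial.induction_on with
  | C a => simp [Polynomial.algebraMap_apply]
  | add p q hp hq => simp [hp, hq]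
  | mul_X p j hp => rw [map_mul, Polynomial.eval_mul, hp, aeval_X, hu]

theorem map_eval_aeval {σ : Type*} (u : σ → Polynomial (MvPolynomial σ ℝ)) (y : σ → ℝ)
    (F : MvPolynomial σ ℝ) :
    (aeval u F).map (eval y) = aeval (fun j => (u j).map (eval y)) F := by
  induction F using MvPolynomial.induction_on with
  | C a => simp [Polynomial.algebraMap_apply]
  | add p q hp hq => simp [hp, hq]
  | mul_X p j hp => rw [map_mul, Polynomial.map_mul, hp, map_mul, aeval_X, aeval_X]

/-- A polynomial that vanishes to order `s` along the affine span of `β` has its homogenization in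
the `(s+1)`-st power of every ideal that contains the linear forms vanishing on the cone of `β`. -/
theorem homogenizeIn_mem_pow {n : ℕ} {β : Finset (Fin n → ℝ)} (hβ : β.Nonempty) {d s : ℕ}
    {q : MvPolynomial (Fin n) ℝ} (hq : q.totalDegree ≤ d)
    (h : ∀ l : List (Fin n), l.length ≤ s → ∀ x ∈ simplex β, eval x (iterPDeriv l q) = 0)
    (I : Ideal (MvPolynomial (Fin (n + 1)) ℝ))
    (hI : ∀ c : Fin (n + 1) → ℝ, (∀ v ∈ β, ∑ j, c j * coneEmbed v j = 0) → linearForm c ∈ I) :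
    homogenizeIn d q ∈ I ^ (s + 1) := by
  obtain ⟨c, M, hmem, hfix⟩ := exists_affine_projection hβ
  -- Coefficients of the homogenized displacement `x_j - c_j x₀ - ∑ M_jk x_k`. It vanishes on the
  -- cone of `β` because the projection fixes the vertices.
  set b : Fin n → Fin (n + 1) → ℝ :=
    fun j => Fin.cons (-c j) (fun k => (if j = k then 1 else 0) - M j k) with hb
  have hbI : ∀ j, linearForm (b j) ∈ I := by
    intro j
    refine hI _ fun v hv => ?_
    rw [Fin.sum_univ_succ]
    simp only [hb, coneEmbed, Fin.cons_zero, Fin.cons_succ, sub_mul, Finset.sum_sub_distrib,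
      ite_mul, one_mul, zero_mul, Finset.sum_ite_eq, Finset.mem_univ, if_true]
    have := hfix v hv j
    linarith
  set F := homogenizeIn d q with hF
  -- The deformation: at `T = 0` it is the projection, at `T = 1` the identity.
  set u : Fin (n + 1) → Polynomial (MvPolynomial (Fin (n + 1)) ℝ) :=
    Fin.cons (Polynomial.C (X 0)) (fun j => Polynomial.C (X j.succ - linearForm (b j)) +
      Polynomial.X * Polynomial.C (linearForm (b j))) with hu
  set G := aeval u F with hG
  -- Every substituted coordinate lies in the Rees algebra of `I`, since `T` occurs only multiplied
  -- by an element of `I`.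
  have hrees : ∀ k, G.coeff k ∈ I ^ k := by
    have : G ∈ (reesAlgebra I).restrictScalars ℝ := by
      have hux : ∀ j, u j ∈ (reesAlgebra I).restrictScalars ℝ := by
        intro j
        refine Fin.cases ?_ (fun j => ?_) j
        · exact (reesAlgebra I).algebraMap_mem (X 0)
        · refine Subalgebra.add_mem _ ((reesAlgebra I).algebraMap_mem _) ?_
          rw [mul_comm, Polynomial.C_mul_X_eq_monomial]
          exact reesAlgebra.monomial_mem.2 (by simpa using hbI j)
      have hle : Algebra.adjoin ℝ (Set.range u) ≤ (reesAlgebra I).restrictScalars ℝ :=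
        Algebra.adjoin_le (Set.range_subset_iff.2 hux)
      rw [Algebra.adjoin_range_eq_range_aeval] at hle
      exact hle ⟨F, rfl⟩
    exact this
  have heval : G.eval 1 = F := by
    refine eval_one_aeval u (fun j => ?_) F
    refine Fin.cases ?_ (fun j => ?_) j
    · simp [hu]
    · simp [hu]
  have hzero : ∀ k ≤ s, G.coeff k = 0 := by
    intro k hk
    -- The factor `X 0` disposes of the points with `y 0 = 0`, where dehomogenizing makes no sense.
    have hz : X 0 * G.coeff k = 0 := by
      refine MvPolynomial.funext fun y => ?_
      rw [map_mul, eval_X, map_zero]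
      by_cases hy : y 0 = 0
      · simp [hy]
      set z : Fin n → ℝ := fun j => (y 0)⁻¹ * y j.succ with hz
      set πz : Fin n → ℝ := fun j => c j + ∑ k, M j k * z k with hπ
      -- For `y 0 ≠ 0` the deformation becomes, up to the factor `y 0 ^ d`, the restriction of `q`
      -- to the line from the projected point to `z`.
      have hG' : G.map (eval y) = Polynomial.C (y 0) ^ d * restrictLine πz (z - πz) q := by
        have h1 : (fun j => (u j).map (eval y)) = (Fin.cons (Polynomial.C (y 0)) (fun j =>
            Polynomial.C (y 0) * (Polynomial.C (πz j) +
              Polynomial.X * Polynomial.C ((z - πz) j))) : Fin (n + 1) → Polynomial ℝ) := by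
          have hlin : ∀ j, eval y (linearForm (b j)) = y 0 * (z - πz) j := by
            intro j
            rw [eval_linearForm, Fin.sum_univ_succ]
            simp only [hb, Fin.cons_zero, Fin.cons_succ, sub_mul, Finset.sum_sub_distrib,
              ite_mul, one_mul, zero_mul, Finset.sum_ite_eq, Finset.mem_univ, if_true,
              Pi.sub_apply, hπ, hz, mul_sub, mul_add, Finset.mul_sum, mul_inv_cancel_left₀ hy]
            have : ∀ k, y 0 * (M j k * ((y 0)⁻¹ * y k.succ)) = M j k * y k.succ := by
              intro k; field_simp
            simp only [this]
            ring
          have hzy : ∀ j : Fin n, y j.succ = y 0 * z j := by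
            intro j; simp only [hz, mul_inv_cancel_left₀ hy]
          funext j
          refine Fin.cases ?_ (fun j => ?_) j
          · simp [hu]
          · simp only [hu, Fin.cons_succ, Polynomial.map_add, Polynomial.map_mul, Polynomial.map_C,
              Polynomial.map_X, map_sub, Polynomial.map_sub, hlin, eval_X, hzy, Pi.sub_apply,
              map_mul]
            ring
        rw [hG, map_eval_aeval, h1, aeval_homogenizeIn hq, restrictLine]
      have hdvd : Polynomial.X ^ (s + 1) ∣ G.map (eval y) := by
        rw [hG']
        refine Dvd.dvd.mul_left (X_pow_dvd_restrictLine _ _ _ _ fun l hl => ?_) _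
        exact eval_eq_zero_of_mem_affineSpan hβ (h l hl) (hmem z)
      have := Polynomial.X_pow_dvd_iff.1 hdvd k (by omega)
      rw [Polynomial.coeff_map] at this
      rw [this, mul_zero]
    exact (mul_eq_zero.1 hz).resolve_left (X_ne_zero _)
  rw [← heval, Polynomial.eval_eq_sum]
  refine Ideal.sum_mem _ fun k _ => ?_
  simp only [one_pow, mul_one]
  by_cases hk : k ≤ s
  · rw [hzero k hk]; exact zero_mem _
  · exact Ideal.pow_le_pow_right (by omega) (hrees k)

/-! ### Linear forms and the ideals of a face -/

theorem exists_eq_linearForm {m : ℕ} {L : MvPolynomial (Fin m) ℝ} (hL : L.IsHomogeneous 1) :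
    ∃ c, L = linearForm c := by
  refine ⟨fun j => L.coeff (Finsupp.single j 1), ?_⟩
  ext α
  rw [linearForm, coeff_sum]
  simp only [coeff_C_mul, coeff_X, mul_ite, mul_one, mul_zero]
  by_cases hα : L.coeff α = 0
  · rw [hα]
    refine (Finset.sum_eq_zero fun j _ => ?_).symm
    split_ifs with h
    · rwa [h]
    · rfl
  · have h1 : α.degree = 1 := by
      rw [Finsupp.degree_eq_weight_one]
      exact hL hα
    obtain ⟨k, rfl⟩ := (Finsupp.sum_eq_one_iff α).1 h1
    rw [Finset.sum_eq_single k]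
    · simp
    · intro j _ hj
      rw [if_neg]
      intro h
      exact hj ((Finsupp.single_left_inj one_ne_zero).1 h)
    · simp

/-- The affine function `x ↦ a₀ + ∑ aⱼ xⱼ`. -/
def affineForm {n : ℕ} (a : Fin (n + 1) → ℝ) (x : Fin n → ℝ) : ℝ := ∑ j, a j * coneEmbed x j

theorem affineForm_eq {n : ℕ} (a : Fin (n + 1) → ℝ) (x : Fin n → ℝ) :
    affineForm a x = a 0 + ∑ j : Fin n, a j.succ * x j := by
  simp [affineForm, coneEmbed, Fin.sum_univ_succ]

theorem eval_dehomogenize {n : ℕ} (q : MvPolynomial (Fin (n + 1)) ℝ) (x : Fin n → ℝ) :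
    eval x (dehomogenize q) = eval (coneEmbed x) q := by
  rw [dehomogenize]
  induction q using MvPolynomial.induction_on with
  | C a => simp
  | add p q hp hq => rw [map_add, map_add, map_add, hp, hq]
  | mul_X p j hp =>
    rw [map_mul, map_mul, hp, map_mul, aeval_X, eval_X]
    congr 1
    refine Fin.cases ?_ (fun j => ?_) j <;> simp [coneEmbed]

theorem eval_dehomogenize_linearForm {n : ℕ} (a : Fin (n + 1) → ℝ) (x : Fin n → ℝ) :
    eval x (dehomogenize (linearForm a)) = affineForm a x := by
  rw [eval_dehomogenize, eval_linearForm, affineForm]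

theorem affineForm_sum {n : ℕ} (a : Fin (n + 1) → ℝ) (S : Finset (Fin n → ℝ))
    (w : (Fin n → ℝ) → ℝ) (hw : ∑ v ∈ S, w v = 1) :
    affineForm a (∑ v ∈ S, w v • v) = ∑ v ∈ S, w v * affineForm a v := by
  simp only [affineForm_eq, mul_add, Finset.sum_add_distrib, ← Finset.sum_mul, hw, one_mul]
  congr 1
  simp only [Finset.sum_apply, Pi.smul_apply, smul_eq_mul, Finset.mul_sum]
  rw [Finset.sum_comm]
  exact Finset.sum_congr rfl fun v _ => Finset.sum_congr rfl fun j _ => by ring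

theorem affineForm_nonneg_of_mem_simplex {n : ℕ} {a : Fin (n + 1) → ℝ} {S : Finset (Fin n → ℝ)}
    (h : ∀ v ∈ S, 0 ≤ affineForm a v) {x : Fin n → ℝ} (hx : x ∈ simplex S) :
    0 ≤ affineForm a x := by
  obtain ⟨w, hw0, hw1, hwx⟩ := Finset.mem_convexHull'.1 hx
  rw [← hwx, affineForm_sum a S w hw1]
  exact Finset.sum_nonneg fun v hv => mul_nonneg (hw0 v hv) (h v hv)

theorem affineForm_eq_zero_of_mem_simplex {n : ℕ} {a : Fin (n + 1) → ℝ} {S : Finset (Fin n → ℝ)}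
    (h : ∀ v ∈ S, affineForm a v = 0) {x : Fin n → ℝ} (hx : x ∈ simplex S) :
    affineForm a x = 0 := by
  obtain ⟨w, hw0, hw1, hwx⟩ := Finset.mem_convexHull'.1 hx
  rw [← hwx, affineForm_sum a S w hw1]
  exact Finset.sum_eq_zero fun v hv => by rw [h v hv, mul_zero]

theorem totalDegree_dehomogenize_linearForm {n : ℕ} (a : Fin (n + 1) → ℝ) :
    (dehomogenize (linearForm a)).totalDegree ≤ 1 := by
  have : dehomogenize (linearForm a) = C (a 0) + ∑ j : Fin n, C (a j.succ) * X j := by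
    simp [dehomogenize, linearForm, Fin.sum_univ_succ, algebraMap_eq]
  rw [this]
  refine (totalDegree_add _ _).trans (max_le (by simp) ?_)
  refine totalDegree_finsetSum_le fun j _ => ?_
  refine (totalDegree_mul _ _).trans ?_
  simp

theorem homogenizeIn_one_dehomogenize_linearForm {n : ℕ} (a : Fin (n + 1) → ℝ) :
    homogenizeIn 1 (dehomogenize (linearForm a)) = linearForm a := by
  refine mul_left_cancel₀ (X_ne_zero (R := ℝ) (0 : Fin (n + 1))) (MvPolynomial.funext fun y => ?_)
  rw [map_mul, map_mul, eval_X]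
  by_cases hy : y 0 = 0
  · simp [hy]
  congr 1
  set z : Fin n → ℝ := fun j => (y 0)⁻¹ * y j.succ
  have hyz : y = (Fin.cons (y 0) (fun j => y 0 * z j) : Fin (n + 1) → ℝ) := by
    funext j
    refine Fin.cases ?_ (fun j => ?_) j
    · simp
    · simp [z, mul_inv_cancel_left₀ hy]
  have h1 := aeval_homogenizeIn (totalDegree_dehomogenize_linearForm a) (y 0) z
  rw [← hyz] at h1
  simp only [← coe_aeval_eq_eval, RingHom.coe_coe]
  rw [h1]
  have h2 := eval_dehomogenize_linearForm a z
  rw [← coe_aeval_eq_eval, RingHom.coe_coe] at h2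
  rw [h2]
  have h3 := eval_linearForm a y
  rw [← coe_aeval_eq_eval, RingHom.coe_coe] at h3
  rw [h3, affineForm_eq, Fin.sum_univ_succ, pow_one, mul_add, Finset.mul_sum, mul_comm (y 0)]
  congr 1
  refine Finset.sum_congr rfl fun j _ => ?_
  simp only [z]
  field_simp

/-- The generators are homogenized in their own degree, so the form is a power of `X 0` times the
generator coming from its dehomogenization. -/
theorem linearForm_mem_faceIdealHom {n : ℕ} {β : Finset (Fin n → ℝ)} {c : Fin (n + 1) → ℝ}
    (hc : ∀ v ∈ β, ∑ j, c j * coneEmbed v j = 0) : linearForm c ∈ faceIdealHom β := by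
  rw [← homogenizeIn_one_dehomogenize_linearForm c,
    homogenizeIn_eq_X_pow_mul (totalDegree_dehomogenize_linearForm c)]
  refine Ideal.mul_mem_left _ _ (Ideal.subset_span ⟨_, ?_, rfl⟩)
  intro x hx
  rw [← RingHom.coe_coe, coe_aeval_eq_eval, eval_dehomogenize_linearForm]
  exact affineForm_eq_zero_of_mem_simplex hc hx

/-- Coordinate `0` of a linear relation between the lifted vertices says that the coefficients sum
to zero, which makes it an affine relation. -/
theorem linearIndependent_coneEmbed {n : ℕ} {β : Finset (Fin n → ℝ)}
    (hβ : AffineIndependent ℝ ((↑) : β → Fin n → ℝ)) :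
    LinearIndependent ℝ (fun v : β => coneEmbed (v : Fin n → ℝ)) := by
  rw [Fintype.linearIndependent_iff]
  intro g hg v
  have h0 : ∑ v : β, g v = 0 := by
    have := congrFun hg 0
    simpa [coneEmbed] using this
  refine affineIndependent_iff.1 hβ Finset.univ g h0 ?_ v (Finset.mem_univ _)
  ext j
  have := congrFun hg j.succ
  simpa [coneEmbed] using this

/-- The linear functional with the given coefficients. -/
def linearFunctional {m : ℕ} (c : Fin m → ℝ) : (Fin m → ℝ) →ₗ[ℝ] ℝ :=
  ∑ j, c j • LinearMap.proj j

theorem linearFunctional_apply {m : ℕ} (c y : Fin m → ℝ) :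
    linearFunctional c y = ∑ j, c j * y j := by
  simp [linearFunctional]

theorem linearFunctional_ne_zero {m : ℕ} {c : Fin m → ℝ} (hc : c ≠ 0) :
    linearFunctional c ≠ 0 := by
  intro h
  apply hc
  ext j
  simpa [linearFunctional_apply, Pi.single_apply] using LinearMap.congr_fun h (Pi.single j 1)

/-- The `n` lifted vertices span a hyperplane of `ℝ^{n+1}`, which is the kernel of `a`; a functional
vanishing on that kernel is a multiple of `a`. -/
theorem exists_smul_of_vanish_on_wall {n : ℕ} {τ : Finset (Fin n → ℝ)}
    (hτ : AffineIndependent ℝ ((↑) : τ → Fin n → ℝ)) (hcard : τ.card = n)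
    {a c : Fin (n + 1) → ℝ} (ha0 : a ≠ 0) (ha : ∀ v ∈ τ, affineForm a v = 0)
    (hc : ∀ v ∈ τ, affineForm c v = 0) : ∃ k : ℝ, c = k • a := by
  set W := Submodule.span ℝ (Set.range fun v : τ => coneEmbed (v : Fin n → ℝ))
  have hle : ∀ b : Fin (n + 1) → ℝ, (∀ v ∈ τ, affineForm b v = 0) →
      W ≤ LinearMap.ker (linearFunctional b) := by
    intro b hb
    refine Submodule.span_le.2 ?_
    rintro _ ⟨v, rfl⟩
    simpa [linearFunctional_apply, affineForm] using hb v v.2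
  have hW : W = LinearMap.ker (linearFunctional a) := by
    refine Submodule.eq_of_le_of_finrank_eq (hle a ha) ?_
    have h1 := Module.Dual.finrank_ker_add_one_of_ne_zero (linearFunctional_ne_zero ha0)
    have h2 := finrank_span_eq_card (linearIndependent_coneEmbed hτ)
    rw [Module.finrank_fin_fun] at h1
    rw [Fintype.card_coe, hcard] at h2
    change Module.finrank ℝ W = n at h2
    omega
  have hker : ⨅ _ : Unit, LinearMap.ker (linearFunctional a) ≤
      LinearMap.ker (linearFunctional c) := by
    simpa [← hW] using hle c hc
  have := mem_span_of_iInf_ker_le_ker (L := fun _ : Unit => linearFunctional a) hker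
  rw [Set.range_const, Submodule.mem_span_singleton] at this
  obtain ⟨k, hk⟩ := this
  refine ⟨k, ?_⟩
  ext j
  simpa [linearFunctional_apply, Pi.single_apply] using
    (LinearMap.congr_fun hk (Pi.single j 1)).symm

theorem exists_affineForm_ne_zero {n : ℕ} {σ : Finset (Fin n → ℝ)}
    (hσ : AffineIndependent ℝ ((↑) : σ → Fin n → ℝ)) (hcard : σ.card = n + 1)
    {a : Fin (n + 1) → ℝ} (ha0 : a ≠ 0) : ∃ v ∈ σ, affineForm a v ≠ 0 := by
  by_contra! h
  refine linearFunctional_ne_zero ha0 ?_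
  have hspan := (linearIndependent_coneEmbed hσ).span_eq_top_of_card_eq_finrank'
    (by simp [hcard])
  refine LinearMap.ext_on_range hspan fun v => ?_
  simpa [linearFunctional_apply, affineForm] using h v v.2

theorem IsWallForm.exists_affineForm {n : ℕ} {τ : Finset (Fin n → ℝ)}
    {ℓ : MvPolynomial (Fin (n + 1)) ℝ} (h : IsWallForm τ ℓ) :
    ∃ a : Fin (n + 1) → ℝ, ℓ = linearForm a ∧ a ≠ 0 ∧ ∀ x ∈ simplex τ, affineForm a x = 0 := by
  obtain ⟨a, rfl⟩ := exists_eq_linearForm h.1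
  refine ⟨a, rfl, ?_, fun x hx => ?_⟩
  · rintro rfl
    exact h.2.1 (by simp [linearForm])
  · have := h.2.2 (coneEmbed x) (subset_convexHull ℝ _ (Or.inr ⟨x, hx, rfl⟩))
    rwa [eval_linearForm] at this

theorem subset_simplex {n : ℕ} (β : Finset (Fin n → ℝ)) : (β : Set (Fin n → ℝ)) ⊆ simplex β :=
  subset_convexHull ℝ _

theorem simplex_mono {n : ℕ} {β γ : Finset (Fin n → ℝ)} (h : β ⊆ γ) : simplex β ⊆ simplex γ :=
  convexHull_mono (by exact_mod_cast h)

theorem linearForm_mem_span_wallForm {n : ℕ} {τ : Finset (Fin n → ℝ)}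
    {ℓ : MvPolynomial (Fin (n + 1)) ℝ} (hτ : AffineIndependent ℝ ((↑) : τ → Fin n → ℝ))
    (hcard : τ.card = n) (h : IsWallForm τ ℓ) {c : Fin (n + 1) → ℝ}
    (hc : ∀ v ∈ τ, ∑ j, c j * coneEmbed v j = 0) : linearForm c ∈ Ideal.span {ℓ} := by
  obtain ⟨a, rfl, ha0, ha⟩ := h.exists_affineForm
  obtain ⟨k, rfl⟩ := exists_smul_of_vanish_on_wall hτ hcard ha0
    (fun v hv => ha v (subset_simplex τ hv)) hc
  refine Ideal.mem_span_singleton.2 ⟨C k, ?_⟩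
  simp only [linearForm, Pi.smul_apply, smul_eq_mul, map_mul, Finset.sum_mul]
  exact Finset.sum_congr rfl fun j _ => by ring

/-! ### Dehomogenizing the ideals -/

/-- Dehomogenization as an algebra homomorphism. -/
noncomputable def dehomogenizeHom (n : ℕ) :
    MvPolynomial (Fin (n + 1)) ℝ →ₐ[ℝ] MvPolynomial (Fin n) ℝ :=
  aeval (Fin.cons 1 (fun j => X j) : Fin (n + 1) → MvPolynomial (Fin n) ℝ)

theorem dehomogenize_mem_faceIdeal_pow {n : ℕ} {β : Finset (Fin n → ℝ)} {k : ℕ}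
    {q : MvPolynomial (Fin (n + 1)) ℝ} (hq : q ∈ faceIdealHom β ^ k) :
    dehomogenize q ∈ faceIdeal β ^ k := by
  have hle : (faceIdealHom β).map (dehomogenizeHom n) ≤ faceIdeal β := by
    rw [faceIdealHom, Ideal.map_span, Ideal.span_le]
    rintro _ ⟨_, ⟨g, hg, rfl⟩, rfl⟩
    have h := dehomogenize_homogenizeIn g.totalDegree g
    change dehomogenize (homogenizeIn g.totalDegree g) ∈ faceIdeal β
    rwa [h]
  have := Ideal.mem_map_of_mem (dehomogenizeHom n) hq
  rw [Ideal.map_pow] at this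
  exact Ideal.pow_right_mono hle k this

theorem dehomogenize_mem_affineWallIdeal {n : ℕ} {Δ : SimplicialComplex ℝ (Fin n → ℝ)} {i : ℕ}
    {r s : Finset (Fin n → ℝ) → ℕ} {τ : Finset (Fin n → ℝ)} {ℓ : MvPolynomial (Fin (n + 1)) ℝ}
    {q : MvPolynomial (Fin (n + 1)) ℝ} (hq : q ∈ wallIdeal Δ i r s τ ℓ) :
    dehomogenize q ∈ affineWallIdeal Δ i r s τ ℓ := by
  obtain ⟨h1, h2⟩ := Submodule.mem_inf.1 hq
  refine Submodule.mem_inf.2 ⟨?_, ?_⟩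
  · obtain ⟨g, rfl⟩ := Ideal.mem_span_singleton.1 h1
    refine Ideal.mem_span_singleton.2 ⟨dehomogenize g, ?_⟩
    change dehomogenizeHom n _ = dehomogenizeHom n _ ^ _ * dehomogenizeHom n _
    rw [map_mul, map_pow]
  · simp only [Submodule.mem_iInf] at h2 ⊢
    exact fun β hβ => dehomogenize_mem_faceIdeal_pow (h2 β hβ)

theorem AffineCriterion.of_homogeneousCriterion {n : ℕ} {Δ : SimplicialComplex ℝ (Fin n → ℝ)}
    {i : ℕ} {r s : Finset (Fin n → ℝ) → ℕ} {ℓ : Finset (Fin n → ℝ) → MvPolynomial (Fin (n + 1)) ℝ}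
    {d : ℕ} {p : Finset (Fin n → ℝ) → MvPolynomial (Fin n) ℝ}
    (h : HomogeneousCriterion Δ i r s ℓ d p) : AffineCriterion Δ i r s ℓ p := by
  intro τ hτ σ hσ σ' hσ' hσσ'
  have := dehomogenize_mem_affineWallIdeal (h τ hτ σ hσ σ' hσ' hσσ')
  rwa [← homogenizeIn_sub, dehomogenize_homogenizeIn] at this

/-! ### Derivatives of elements of powers of an ideal -/

theorem pderiv_mem_pow {σ : Type*} (I : Ideal (MvPolynomial σ ℝ)) (j : σ) (k : ℕ)
    {q : MvPolynomial σ ℝ} (hq : q ∈ I ^ (k + 1)) : pderiv j q ∈ I ^ k := by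
  induction k generalizing q with
  | zero => simp
  | succ k ih =>
    rw [pow_succ] at hq
    refine Submodule.mul_induction_on hq (fun a ha b hb => ?_) fun a b ha hb => ?_
    · rw [pderiv_mul]
      refine add_mem ?_ (Ideal.mul_mem_right _ _ ha)
      rw [pow_succ]
      exact Ideal.mul_mem_mul (ih ha) hb
    · rw [map_add]
      exact add_mem ha hb

theorem iterPDeriv_mem_pow {n : ℕ} (I : Ideal (MvPolynomial (Fin n) ℝ)) (l : List (Fin n)) (k : ℕ)
    {q : MvPolynomial (Fin n) ℝ} (hq : q ∈ I ^ (k + l.length)) : iterPDeriv l q ∈ I ^ k := by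
  induction l generalizing k with
  | nil => simpa [iterPDeriv] using hq
  | cons j l ih =>
    refine pderiv_mem_pow I j k (ih (k + 1) ?_)
    rwa [List.length_cons, ← add_assoc, add_right_comm] at hq

/-- By the Leibniz rule each derivative costs at most one power of the ideal, so after at most `s`
of them one factor is left. -/
theorem eval_iterPDeriv_eq_zero {n : ℕ} {β : Finset (Fin n → ℝ)} {s : ℕ}
    {q : MvPolynomial (Fin n) ℝ} (hq : q ∈ faceIdeal β ^ (s + 1)) {l : List (Fin n)}
    (hl : l.length ≤ s) {x : Fin n → ℝ} (hx : x ∈ simplex β) : eval x (iterPDeriv l q) = 0 := by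
  have h1 : iterPDeriv l q ∈ faceIdeal β ^ 1 :=
    iterPDeriv_mem_pow _ l 1 (Ideal.pow_le_pow_right (by omega) hq)
  rw [pow_one] at h1
  have := h1 x hx
  rwa [← RingHom.coe_coe, coe_aeval_eq_eval] at this

/-! ### Polynomial functions and their derivatives -/

theorem contDiff_eval {n : ℕ} (k : WithTop ℕ∞) (q : MvPolynomial (Fin n) ℝ) :
    ContDiff ℝ k (fun x : Fin n → ℝ => eval x q) := by
  induction q using MvPolynomial.induction_on with
  | C a => simpa using contDiff_const
  | add p q hp hq => simpa using hp.add hq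
  | mul_X p j hp => simpa using hp.mul (contDiff_apply ℝ ℝ j)

theorem fderiv_eval_single {n : ℕ} (q : MvPolynomial (Fin n) ℝ) (x : Fin n → ℝ) (j : Fin n) :
    fderiv ℝ (fun y : Fin n → ℝ => eval y q) x (Pi.single j 1) = eval x (pderiv j q) := by
  have hdiff : ∀ p : MvPolynomial (Fin n) ℝ, DifferentiableAt ℝ (fun y => eval y p) x :=
    fun p => (contDiff_eval 1 p).differentiable one_ne_zero x
  induction q using MvPolynomial.induction_on with
  | C a => simp
  | add p q hp hq =>
    simp only [map_add]
    rw [fderiv_fun_add (hdiff p) (hdiff q), add_apply, hp, hq]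
  | mul_X p k hp =>
    have h1 : (fun y : Fin n → ℝ => eval y (p * X k)) = fun y => eval y p * y k := by
      funext y; simp
    rw [h1, fderiv_fun_mul (hdiff p) (differentiableAt_apply k x), add_apply,
      smul_apply, smul_apply, hp, pderiv_mul,
      (hasFDerivAt_apply k x).fderiv]
    by_cases h : k = j
    · subst h; simp; ring
    · simp [h, pderiv_X, mul_comm]

theorem iteratedFDeriv_eval_single {n : ℕ} (q : MvPolynomial (Fin n) ℝ) (l : List (Fin n))
    (x : Fin n → ℝ) :
    iteratedFDeriv ℝ l.length (fun y : Fin n → ℝ => eval y q) x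
      (fun i => Pi.single (l.get i) 1) = eval x (iterPDeriv l q) := by
  induction l generalizing x with
  | nil => simp [iterPDeriv]
  | cons j l ih =>
    have hd : DifferentiableAt ℝ (iteratedFDeriv ℝ l.length fun y : Fin n → ℝ => eval y q) x :=
      ((contDiff_eval (l.length + 1 : ℕ) q).differentiable_iteratedFDeriv
        (by exact_mod_cast Nat.lt_succ_self _)) x
    set m : Fin (l.length + 1) → Fin n → ℝ := fun i => Pi.single ((j :: l).get i) 1
    have h2 : (fun y => iteratedFDeriv ℝ l.length (fun y : Fin n → ℝ => eval y q) y
        (Fin.tail m)) = fun y => eval y (iterPDeriv l q) := funext fun y => ih y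
    refine (hd.iteratedFDeriv_succ_apply_left' (m := m)).trans ?_
    rw [h2]
    exact fderiv_eval_single _ x j

/-- The right-hand side involves neither `q` nor `T`, so any two pieces of a `C^r` function have
equal derivatives at common points. Unique differentiability of `T` lets the Taylor series of `f`
within `S` be computed within `T`, where `f` is `q`. -/
theorem eval_iterPDeriv_eq_iteratedFDerivWithin {n : ℕ} {S T : Set (Fin n → ℝ)}
    (hS : UniqueDiffOn ℝ S) (hT : UniqueDiffOn ℝ T) (hTS : T ⊆ S) {f : (Fin n → ℝ) → ℝ} {r : ℕ}
    (hf : ContDiffOn ℝ r f S) {q : MvPolynomial (Fin n) ℝ} (hfq : ∀ x ∈ T, f x = eval x q)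
    {x : Fin n → ℝ} (hx : x ∈ T) {l : List (Fin n)} (hl : l.length ≤ r) :
    eval x (iterPDeriv l q) =
      iteratedFDerivWithin ℝ l.length f S x (fun i => Pi.single (l.get i) 1) := by
  have h1 := ((hf.ftaylorSeriesWithin hS).mono hTS).eq_iteratedFDerivWithin_of_uniqueDiffOn
    (m := l.length) (by exact_mod_cast hl) hT hx
  change iteratedFDerivWithin ℝ l.length f S x = _ at h1
  rw [h1, iteratedFDerivWithin_congr hfq hx, iteratedFDerivWithin_eq_iteratedFDeriv hT
    (contDiff_eval _ q).contDiffAt hx, iteratedFDeriv_eval_single]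

/-- Induction through the derivative, a multiple of the next lower truncated power; at `0` the two
one-sided derivatives are glued. -/
theorem contDiff_max_zero_pow (r : ℕ) : ContDiff ℝ r (fun t : ℝ => max t 0 ^ (r + 1)) := by
  induction r with
  | zero =>
    rw [Nat.cast_zero, contDiff_zero]
    fun_prop
  | succ r ih =>
    have hder : ∀ t : ℝ, HasDerivAt (fun t : ℝ => max t 0 ^ (r + 1 + 1))
        (((r + 1 + 1 : ℕ) : ℝ) * max t 0 ^ (r + 1)) t := by
      intro t
      have hpos : ∀ t : ℝ, 0 ≤ t → HasDerivWithinAt (fun t : ℝ => max t 0 ^ (r + 1 + 1))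
          (((r + 1 + 1 : ℕ) : ℝ) * max t 0 ^ (r + 1)) (Set.Ici 0) t := by
        intro t ht
        rw [max_eq_left ht]
        refine ((hasDerivAt_pow (r + 1 + 1) t).hasDerivWithinAt).congr (fun u hu => ?_) ?_
        · rw [max_eq_left hu]
        · rw [max_eq_left ht]
      have hneg : ∀ t : ℝ, t ≤ 0 → HasDerivWithinAt (fun t : ℝ => max t 0 ^ (r + 1 + 1))
          (((r + 1 + 1 : ℕ) : ℝ) * max t 0 ^ (r + 1)) (Set.Iic 0) t := by
        intro t ht
        rw [max_eq_right ht, zero_pow (by omega), mul_zero]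
        refine (hasDerivWithinAt_const t _ (0 : ℝ)).congr (fun u hu => ?_) ?_
        · rw [max_eq_right hu, zero_pow (by omega)]
        · rw [max_eq_right ht, zero_pow (by omega)]
      rcases lt_trichotomy t 0 with h | h | h
      · exact (hneg t h.le).hasDerivAt (Iic_mem_nhds h)
      · have := (hpos t h.ge).union (hneg t h.le)
        rwa [Set.Ici_union_Iic, hasDerivWithinAt_univ] at this
      · exact (hpos t h.le).hasDerivAt (Ici_mem_nhds h)
    rw [Nat.cast_succ, contDiff_succ_iff_deriv]
    refine ⟨fun t => (hder t).differentiableAt, fun h => ?_, ?_⟩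
    · exact absurd h (by simp)
    · rw [funext fun t => (hder t).deriv]
      exact contDiff_const.mul ih

/-! ### Simplices of full dimension -/

section Geometry

variable {n : ℕ} {Δ : SimplicialComplex ℝ (Fin n → ℝ)}

theorem exists_iFace_superset (hfin : Δ.faces.Finite) (hpure : IsPure Δ)
    {t : Finset (Fin n → ℝ)} (ht : t ∈ Δ.faces) : ∃ σ ∈ iFaces Δ n, t ⊆ σ := by
  obtain ⟨σ, hle, hσ⟩ := hfin.exists_le_maximal ht
  refine ⟨σ, ⟨hσ.prop, hpure σ ⟨hσ.prop, fun u hu hσu => ?_⟩⟩, hle⟩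
  exact le_antisymm hσu (hσ.le_of_ge hu hσu)

theorem affineSpan_iFace {σ : Finset (Fin n → ℝ)} (hσ : σ ∈ iFaces Δ n) :
    affineSpan ℝ (σ : Set (Fin n → ℝ)) = ⊤ := by
  have := (Δ.indep hσ.1).affineSpan_eq_top_iff_card_eq_finrank_add_one.2 (by simp [hσ.2])
  simpa using this

theorem uniqueDiffOn_simplex {σ : Finset (Fin n → ℝ)} (hσ : σ ∈ iFaces Δ n) :
    UniqueDiffOn ℝ (simplex σ) :=
  uniqueDiffOn_convex (convex_convexHull ℝ _)
    (interior_convexHull_nonempty_iff_affineSpan_eq_top.2 (affineSpan_iFace hσ))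

theorem isClosed_simplex (σ : Finset (Fin n → ℝ)) : IsClosed (simplex σ) :=
  σ.finite_toSet.isClosed_convexHull ℝ

theorem IsPiece.unique {σ : Finset (Fin n → ℝ)} (hσ : σ ∈ iFaces Δ n) {f : (Fin n → ℝ) → ℝ}
    {p q : MvPolynomial (Fin n) ℝ} (hp : IsPiece f σ p) (hq : IsPiece f σ q) : p = q := by
  refine sub_eq_zero.1 (MvPolynomial.funext fun x => ?_)
  rw [map_zero]
  refine eval_eq_zero_of_mem_affineSpan (Δ.nonempty_of_mem_faces hσ.1) (fun y hy => ?_)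
    (affineSpan_iFace hσ ▸ AffineSubspace.mem_top ℝ _ x)
  rw [map_sub, ← hp y hy, ← hq y hy, sub_self]

theorem mem_space_iff_iFace (hfin : Δ.faces.Finite) (hpure : IsPure Δ) {x : Fin n → ℝ} :
    x ∈ Δ.space ↔ ∃ σ ∈ iFaces Δ n, x ∈ simplex σ := by
  rw [SimplicialComplex.mem_space_iff]
  constructor
  · rintro ⟨t, ht, hx⟩
    obtain ⟨σ, hσ, htσ⟩ := exists_iFace_superset hfin hpure ht
    exact ⟨σ, hσ, simplex_mono htσ hx⟩
  · rintro ⟨σ, hσ, hx⟩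
    exact ⟨σ, hσ.1, hx⟩

theorem mem_faceStar_space_iff (hfin : Δ.faces.Finite) (hpure : IsPure Δ)
    {τ : Finset (Fin n → ℝ)} {x : Fin n → ℝ} :
    x ∈ (faceStar Δ τ).space ↔ ∃ σ ∈ iFaces Δ n, τ ⊆ σ ∧ x ∈ simplex σ := by
  rw [SimplicialComplex.mem_space_iff]
  constructor
  · rintro ⟨t, ⟨-, ρ, hρ, hτρ, htρ⟩, hx⟩
    obtain ⟨σ, hσ, hρσ⟩ := exists_iFace_superset hfin hpure hρ
    exact ⟨σ, hσ, hτρ.trans hρσ, simplex_mono (htρ.trans hρσ) hx⟩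
  · rintro ⟨σ, hσ, hτσ, hx⟩
    exact ⟨σ, ⟨Δ.nonempty_of_mem_faces hσ.1, σ, hσ.1, hτσ, subset_rfl⟩, hx⟩

theorem iFaces_faceStar_subset (τ : Finset (Fin n → ℝ)) (i : ℕ) :
    iFaces (faceStar Δ τ) i ⊆ iFaces Δ i := by
  rintro t ⟨⟨hne, ρ, hρ, -, htρ⟩, hc⟩
  exact ⟨Δ.down_closed hρ htρ hne, hc⟩

/-- Each point of the star lies in an `n`-simplex inside it, a convex set with nonempty interior. -/
theorem uniqueDiffOn_faceStar_space (hfin : Δ.faces.Finite) (hpure : IsPure Δ)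
    (τ : Finset (Fin n → ℝ)) : UniqueDiffOn ℝ (faceStar Δ τ).space := by
  intro x hx
  obtain ⟨σ, hσ, hτσ, hxσ⟩ := (mem_faceStar_space_iff hfin hpure).1 hx
  exact (uniqueDiffOn_simplex hσ x hxσ).mono fun y hy =>
    (mem_faceStar_space_iff hfin hpure).2 ⟨σ, hσ, hτσ, hy⟩

theorem continuousOn_space_of_pieces (hfin : Δ.faces.Finite) (hpure : IsPure Δ)
    {f : (Fin n → ℝ) → ℝ} {p : Finset (Fin n → ℝ) → MvPolynomial (Fin n) ℝ}
    (hf : ∀ σ ∈ iFaces Δ n, IsPiece f σ (p σ)) : ContinuousOn f Δ.space := by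
  have : Finite (iFaces Δ n) := (hfin.subset fun _ h => h.1).to_subtype
  have h := (locallyFinite_of_finite fun σ : iFaces Δ n => simplex σ.1).continuousOn_iUnion
    (g := f) (fun σ => isClosed_simplex σ.1)
    (fun σ => (contDiff_eval 0 (p σ.1)).continuous.continuousOn.congr (hf σ.1 σ.2))
  refine h.mono fun x hx => ?_
  obtain ⟨σ, hσ, hxσ⟩ := (mem_space_iff_iFace hfin hpure).1 hx
  exact Set.mem_iUnion.2 ⟨⟨σ, hσ⟩, hxσ⟩

/-! ### The two sides of a wall -/

theorem mem_or_eq_of_card {α : Type*} {τ σ : Finset α} (hτσ : τ ⊆ σ)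
    (hcard : σ.card = τ.card + 1) {u v : α} (hv : v ∈ σ) (hvτ : v ∉ τ) (hu : u ∈ σ) :
    u ∈ τ ∨ u = v := by
  classical
  have h1 : insert v τ = σ := Finset.eq_of_subset_of_card_le
    (Finset.insert_subset hv hτσ) (by rw [Finset.card_insert_of_notMem hvτ, hcard])
  rw [← h1, Finset.mem_insert] at hu
  exact hu.symm

theorem coe_inter_coe_eq_of_ne {α : Type*} {τ σ σ' : Finset α} (hτσ : τ ⊆ σ) (hτσ' : τ ⊆ σ')
    (hcard : σ.card = τ.card + 1) (hcard' : σ'.card = τ.card + 1) (hne : σ ≠ σ') :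
    (σ ∩ σ' : Set α) = τ := by
  classical
  refine Set.Subset.antisymm (fun v hv => ?_) (Set.subset_inter hτσ hτσ')
  by_contra hvτ
  apply hne
  have h1 : ∀ ρ : Finset α, τ ⊆ ρ → ρ.card = τ.card + 1 → v ∈ ρ → insert v τ = ρ :=
    fun ρ hτρ hc hvρ => Finset.eq_of_subset_of_card_le
      (Finset.insert_subset hvρ hτρ) (by rw [Finset.card_insert_of_notMem hvτ, hc])
  rw [← h1 σ hτσ hcard hv.1, h1 σ' hτσ' hcard' hv.2]

/-- Two simplices of full dimension that lie on the same side of a common wall are equal. -/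
theorem eq_of_same_side {τ σ σ' : Finset (Fin n → ℝ)} (hσ : σ ∈ iFaces Δ n)
    (hσ' : σ' ∈ iFaces Δ n) (hτσ : τ ⊆ σ) (hτσ' : τ ⊆ σ') (hn : 0 < n) (hcard : τ.card = n)
    {a : Fin (n + 1) → ℝ} (ha : ∀ x ∈ simplex τ, affineForm a x = 0) {v v' : Fin n → ℝ}
    (hv : v ∈ σ) (hv' : v' ∈ σ') (hpos : 0 < affineForm a v * affineForm a v') : σ = σ' := by
  classical
  by_contra hne
  have hvτ : v ∉ τ := fun h => by
    rw [ha v (subset_simplex τ h), zero_mul] at hpos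
    exact lt_irrefl _ hpos
  have hinter := coe_inter_coe_eq_of_ne hτσ hτσ' (by rw [hσ.2, hcard]) (by rw [hσ'.2, hcard]) hne
  have hform : ∀ w : (Fin n → ℝ) → ℝ, ∑ u ∈ σ, w u = 1 →
      affineForm a (∑ u ∈ σ, w u • u) = w v * affineForm a v := by
    intro w hw
    rw [affineForm_sum a σ w hw]
    refine Finset.sum_eq_single v (fun u hu huv => ?_) (fun h => absurd hv h)
    have := (mem_or_eq_of_card hτσ (by rw [hσ.2, hcard]) hv hvτ hu).resolve_right huv
    rw [ha u (subset_simplex τ this), mul_zero]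
  obtain ⟨w, hw1, hwv'⟩ := exists_weights_of_mem_affineSpan (β := σ) (y := v')
    (affineSpan_iFace hσ ▸ AffineSubspace.mem_top ℝ _ v')
  -- All vertices of `σ` but `v` lie in the wall, so the form takes the value `w v * affineForm a v`
  -- at `v'`.
  have hwv : 0 < w v := by
    rw [← hwv', hform w hw1] at hpos
    by_contra! h
    nlinarith [mul_self_nonneg (affineForm a v)]
  have hn' : (0 : ℝ) < n := by exact_mod_cast hn
  -- Weights of the barycentre of `τ`. The family `W` moves from it towards `v'`; for small `ε > 0`
  -- the point lies in both simplices, hence in `τ`, yet the form is nonzero there.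
  set b : (Fin n → ℝ) → ℝ := fun u => if u ∈ τ then (n : ℝ)⁻¹ else 0 with hb
  set W : ℝ → (Fin n → ℝ) → ℝ := fun ε u => (1 - ε) * b u + ε * w u with hW
  have hev : ∀ᶠ ε in nhdsWithin (0 : ℝ) (Set.Ioi 0), ∀ u ∈ τ, 0 < W ε u := by
    refine Filter.Eventually.filter_mono nhdsWithin_le_nhds ?_
    refine (Filter.eventually_all_finset τ).2 fun u hu => ?_
    have hc : Continuous fun ε : ℝ => W ε u := by simp only [hW]; fun_prop
    refine hc.continuousAt.eventually (lt_mem_nhds ?_)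
    simpa [hW, hb, hu] using hn
  have hev1 : ∀ᶠ ε in nhdsWithin (0 : ℝ) (Set.Ioi 0), ε < 1 :=
    Filter.Eventually.filter_mono nhdsWithin_le_nhds (gt_mem_nhds one_pos)
  obtain ⟨ε, ⟨hε, hε1⟩, hε0⟩ := ((hev.and hev1).and self_mem_nhdsWithin).exists
  have hε0 : 0 < ε := hε0
  have hW0 : ∀ u ∈ σ, 0 ≤ W ε u := by
    intro u hu
    rcases mem_or_eq_of_card hτσ (by rw [hσ.2, hcard]) hv hvτ hu with h | rfl
    · exact (hε u h).le
    · simp only [hW, hb, if_neg hvτ, mul_zero, zero_add]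
      positivity
  have hbτ : ∑ u ∈ σ, b u = 1 := by
    rw [hb, Finset.sum_ite_mem, Finset.inter_eq_right.2 hτσ]
    simp [hcard, hn'.ne']
  have hW1 : ∑ u ∈ σ, W ε u = 1 := by
    simp only [hW]
    rw [Finset.sum_add_distrib, ← Finset.mul_sum, ← Finset.mul_sum, hbτ, hw1]
    ring
  set x := ∑ u ∈ σ, W ε u • u with hx
  have hxσ : x ∈ simplex σ := (convex_convexHull ℝ _).sum_mem hW0 hW1
    fun u hu => subset_simplex σ hu
  have hxσ' : x ∈ simplex σ' := by
    have hx2 : x = (1 - ε) • (∑ u ∈ σ, b u • u) + ε • v' := by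
      rw [← hwv', Finset.smul_sum, Finset.smul_sum, ← Finset.sum_add_distrib]
      exact Finset.sum_congr rfl fun u _ => by simp only [hW]; module
    rw [hx2]
    refine (convex_convexHull ℝ _) ?_ (subset_simplex σ' hv') (by linarith) hε0.le (by ring)
    refine simplex_mono hτσ' ?_
    have hb2 : ∑ u ∈ σ, b u • u = ∑ u ∈ τ, (n : ℝ)⁻¹ • u := by
      simp only [hb, ite_smul, zero_smul]
      rw [Finset.sum_ite_mem, Finset.inter_eq_right.2 hτσ]
    rw [hb2]
    refine (convex_convexHull ℝ _).sum_mem (fun _ _ => by positivity) ?_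
      fun u hu => subset_simplex τ hu
    simp [hcard, hn'.ne']
  have hxτ : x ∈ simplex τ := by
    have := Δ.inter_subset_convexHull hσ.1 hσ'.1 ⟨hxσ, hxσ'⟩
    rwa [hinter] at this
  have h0 := ha x hxτ
  rw [hx, hform _ hW1] at h0
  have hv0 : affineForm a v ≠ 0 := fun h => by simp [h] at hpos
  have hWv : W ε v = ε * w v := by simp [hW, hb, hvτ]
  rw [hWv] at h0
  exact (mul_ne_zero (mul_pos hε0 hwv).ne' hv0) h0

end Geometry

section Splines

variable {n : ℕ} {Δ : SimplicialComplex ℝ (Fin n → ℝ)}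

/-! ### Smoothness across a wall -/

theorem contDiffOn_faceStar_space (hfin : Δ.faces.Finite) (hpure : IsPure Δ) (hn : 0 < n)
    {f : (Fin n → ℝ) → ℝ} {p : Finset (Fin n → ℝ) → MvPolynomial (Fin n) ℝ}
    (hf : ∀ σ ∈ iFaces Δ n, IsPiece f σ (p σ)) {τ : Finset (Fin n → ℝ)}
    (hτ : τ ∈ interiorWalls Δ) {ℓ : MvPolynomial (Fin (n + 1)) ℝ} (hℓ : IsWallForm τ ℓ) {r : ℕ}
    (hdvd : ∀ σ ∈ iFaces Δ n, ∀ σ' ∈ iFaces Δ n, (σ ∩ σ' : Set (Fin n → ℝ)) = τ →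
      dehomogenize ℓ ^ (r + 1) ∣ p σ - p σ') :
    ContDiffOn ℝ r f (faceStar Δ τ).space := by
  obtain ⟨a, rfl, ha0, ha⟩ := hℓ.exists_affineForm
  obtain ⟨-, hcard, ρ, hρ, ρ', hρ', hne, hτρ, hτρ'⟩ := hτ
  have hvert : ∀ σ ∈ iFaces Δ n, ∃ v ∈ σ, affineForm a v ≠ 0 :=
    fun σ hσ => exists_affineForm_ne_zero (Δ.indep hσ.1) hσ.2 ha0
  have key : ∀ σ₁ ∈ iFaces Δ n, ∀ σ₂ ∈ iFaces Δ n, τ ⊆ σ₁ → τ ⊆ σ₂ → σ₁ ≠ σ₂ →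
      ∀ v₁ ∈ σ₁, ∀ v₂ ∈ σ₂, 0 < affineForm a v₁ → affineForm a v₂ < 0 →
      ContDiffOn ℝ r f (faceStar Δ τ).space := by
    intro σ₁ hσ₁ σ₂ hσ₂ hτ₁ hτ₂ hne v₁ hv₁ v₂ hv₂ hpos hneg
    obtain ⟨g, hg⟩ := hdvd σ₁ hσ₁ σ₂ hσ₂
      (coe_inter_coe_eq_of_ne hτ₁ hτ₂ (by rw [hσ₁.2, hcard]) (by rw [hσ₂.2, hcard]) hne)
    have hsub : ∀ x, eval x (p σ₁) = eval x (p σ₂) + affineForm a x ^ (r + 1) * eval x g := by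
      intro x
      have := congrArg (eval x) hg
      rw [map_sub, map_mul, map_pow, eval_dehomogenize_linearForm] at this
      linarith
    have hmax : ContDiff ℝ r fun x : Fin n → ℝ => max (affineForm a x) 0 ^ (r + 1) := by
      have : ContDiff ℝ r fun x : Fin n → ℝ => affineForm a x := by
        simp only [← eval_dehomogenize_linearForm]
        exact contDiff_eval _ _
      exact (contDiff_max_zero_pow r).comp this
    -- A global `C^r` function: it equals `p σ₂` on the negative side and, by `hsub`, `p σ₁` on the
    -- positive side.
    refine ((contDiff_eval r (p σ₂)).add (hmax.mul (contDiff_eval r g))).contDiffOn.congr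
      fun x hx => ?_
    have hcases : ∀ σ ∈ iFaces Δ n, τ ⊆ σ → ∀ v ∈ σ, affineForm a v ≠ 0 → ∀ u ∈ σ,
        affineForm a u = 0 ∨ u = v := by
      intro σ hσ hτσ v hv hv0 u hu
      have hvτ : v ∉ τ := fun h => hv0 (ha v (subset_simplex τ h))
      exact (mem_or_eq_of_card hτσ (by rw [hσ.2, hcard]) hv hvτ hu).imp_left
        fun h => ha u (subset_simplex τ h)
    obtain ⟨σ, hσ, hτσ, hxσ⟩ := (mem_faceStar_space_iff hfin hpure).1 hx
    obtain ⟨v, hv, hv0⟩ := hvert σ hσ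
    rcases hv0.lt_or_gt with hv0 | hv0
    · obtain rfl := eq_of_same_side hσ hσ₂ hτσ hτ₂ hn hcard ha hv hv₂
        (mul_pos_of_neg_of_neg hv0 hneg)
      have hle : affineForm a x ≤ 0 := by
        have h1 : ∀ y, affineForm (-a) y = -affineForm a y := fun y => by simp [affineForm]
        have := affineForm_nonneg_of_mem_simplex (a := -a) (S := σ) (x := x) (fun u hu => by
          rw [h1]
          rcases hcases σ hσ hτσ v hv hv0.ne u hu with h | rfl <;> linarith) hxσ
        rw [h1] at this
        linarith
      rw [hf σ hσ x hxσ, max_eq_right hle, zero_pow (by omega), zero_mul, add_zero]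
    · obtain rfl := eq_of_same_side hσ hσ₁ hτσ hτ₁ hn hcard ha hv hv₁ (mul_pos hv0 hpos)
      have hge : 0 ≤ affineForm a x := affineForm_nonneg_of_mem_simplex (fun u hu => by
        rcases hcases σ hσ hτσ v hv hv0.ne' u hu with h | rfl <;> linarith) hxσ
      rw [hf σ hσ x hxσ, max_eq_left hge, hsub]
  obtain ⟨v, hv, hv0⟩ := hvert ρ hρ
  obtain ⟨v', hv', hv0'⟩ := hvert ρ' hρ'
  have hside : ¬ 0 < affineForm a v * affineForm a v' := fun h =>
    hne (eq_of_same_side hρ hρ' hτρ hτρ' hn hcard ha hv hv' h)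
  rcases hv0.lt_or_gt with h | h <;> rcases hv0'.lt_or_gt with h' | h'
  · exact absurd (mul_pos_of_neg_of_neg h h') hside
  · exact key ρ' hρ' ρ hρ hτρ' hτρ hne.symm v' hv' v hv h' h
  · exact key ρ hρ ρ' hρ' hτρ hτρ' hne v hv v' hv' h h'
  · exact absurd (mul_pos h h') hside

/-! ### Chains of simplices -/

/-- The chain supplied for the face `σ ∩ σ'` keeps `β` in all its members, so every wall crossed
contains `β`. The invariant `φ` will be the value of a piece, or of one of its derivatives, at a
fixed point of `β`. -/
theorem IsHereditary.eq_of_walls (hher : IsHereditary Δ) {α : Type*}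
    (φ : Finset (Fin n → ℝ) → α) {β σ σ' : Finset (Fin n → ℝ)} (hβ : β.Nonempty)
    (hσ : σ ∈ iFaces Δ n) (hσ' : σ' ∈ iFaces Δ n) (hβσ : β ⊆ σ) (hβσ' : β ⊆ σ')
    (h : ∀ τ ∈ interiorWalls Δ, β ⊆ τ → ∀ ρ ∈ iFaces Δ n, ∀ ρ' ∈ iFaces Δ n,
      (ρ ∩ ρ' : Set (Fin n → ℝ)) = τ → φ ρ = φ ρ') : φ σ = φ σ' := by
  classical
  have hγ : β ⊆ σ ∩ σ' := Finset.subset_inter hβσ hβσ'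
  obtain ⟨m, c, rfl, rfl, hc, hwall⟩ := hher σ hσ σ' hσ' (σ ∩ σ')
    (Δ.down_closed hσ.1 Finset.inter_subset_left (hβ.mono hγ)) (by rw [Finset.coe_inter])
  have hind : ∀ j ≤ m, φ (c 0) = φ (c j) := by
    intro j
    induction j with
    | zero => exact fun _ => rfl
    | succ j ih =>
      intro hj
      obtain ⟨τ, hτ, heq⟩ := hwall j hj
      refine (ih (by omega)).trans (h τ hτ ?_ _ (hc j (by omega)).1 _ (hc (j + 1) hj).1 heq)
      rw [← Finset.coe_subset, ← heq]
      exact Set.subset_inter (hγ.trans (hc j (by omega)).2) (hγ.trans (hc (j + 1) hj).2)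
  exact hind m le_rfl

/-! ### Passing between splines and the algebraic criteria. -/

variable {i : ℕ} {r s : Finset (Fin n → ℝ) → ℕ}
  {ℓ : Finset (Fin n → ℝ) → MvPolynomial (Fin (n + 1)) ℝ}
  {p : Finset (Fin n → ℝ) → MvPolynomial (Fin n) ℝ}

theorem AffineCriterion.dvd (h : AffineCriterion Δ i r s ℓ p) {τ : Finset (Fin n → ℝ)}
    (hτ : τ ∈ interiorWalls Δ) {σ σ' : Finset (Fin n → ℝ)} (hσ : σ ∈ iFaces Δ n)
    (hσ' : σ' ∈ iFaces Δ n) (hσσ' : (σ ∩ σ' : Set (Fin n → ℝ)) = τ) :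
    dehomogenize (ℓ τ) ^ (r τ + 1) ∣ p σ - p σ' :=
  Ideal.mem_span_singleton.1 (Submodule.mem_inf.1 (h τ hτ σ hσ σ' hσ' hσσ')).1

/-- A common point of the two simplices lies in the simplex on their shared vertices, so each wall
on the chain contains it and its form vanishes there. -/
theorem AffineCriterion.eval_eq (hher : IsHereditary Δ)
    (hℓ : ∀ τ ∈ interiorWalls Δ, IsWallForm τ (ℓ τ)) (h : AffineCriterion Δ i r s ℓ p)
    {σ σ' : Finset (Fin n → ℝ)} (hσ : σ ∈ iFaces Δ n) (hσ' : σ' ∈ iFaces Δ n) {x : Fin n → ℝ}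
    (hx : x ∈ simplex σ) (hx' : x ∈ simplex σ') : eval x (p σ) = eval x (p σ') := by
  classical
  have hxβ : x ∈ simplex (σ ∩ σ') := by
    rw [simplex, Finset.coe_inter]
    exact Δ.inter_subset_convexHull hσ.1 hσ'.1 ⟨hx, hx'⟩
  have hβ : (σ ∩ σ').Nonempty := by
    rw [← Finset.coe_nonempty, ← convexHull_nonempty_iff (𝕜 := ℝ)]
    exact ⟨x, hxβ⟩
  refine hher.eq_of_walls (fun ρ => eval x (p ρ)) hβ hσ hσ' Finset.inter_subset_left
    Finset.inter_subset_right fun τ hτ hβτ ρ hρ ρ' hρ' hρρ' => ?_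
  obtain ⟨g, hg⟩ := h.dvd hτ hρ hρ' hρρ'
  obtain ⟨a, hae, -, ha⟩ := (hℓ τ hτ).exists_affineForm
  have := congrArg (eval x) hg
  rw [hae, map_sub, map_mul, map_pow, eval_dehomogenize_linearForm, ha x (simplex_mono hβτ hxβ),
    zero_pow (by omega), zero_mul] at this
  exact sub_eq_zero.1 this

theorem AffineCriterion.exists_function (hher : IsHereditary Δ)
    (hℓ : ∀ τ ∈ interiorWalls Δ, IsWallForm τ (ℓ τ)) (h : AffineCriterion Δ i r s ℓ p) :
    ∃ f : (Fin n → ℝ) → ℝ, ∀ σ ∈ iFaces Δ n, IsPiece f σ (p σ) := by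
  classical
  refine ⟨fun x => if hx : ∃ σ ∈ iFaces Δ n, x ∈ simplex σ then eval x (p hx.choose) else 0,
    fun σ hσ x hxσ => ?_⟩
  have hx : ∃ σ ∈ iFaces Δ n, x ∈ simplex σ := ⟨σ, hσ, hxσ⟩
  simp only [dif_pos hx]
  exact h.eval_eq hher hℓ hx.choose_spec.1 hσ hx.choose_spec.2 hxσ

theorem AffineCriterion.isSupersmoothAt (hher : IsHereditary Δ)
    (h : AffineCriterion Δ i r s ℓ p) {f : (Fin n → ℝ) → ℝ}
    (hf : ∀ σ ∈ iFaces Δ n, IsPiece f σ (p σ)) {β : Finset (Fin n → ℝ)} (hβ : β ∈ iFaces Δ i) :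
    IsSupersmoothAt Δ f β (s β) := by
  intro σ hσ σ' hσ' hβσ hβσ' q q' hq hq' l hl x hx
  rw [hq.unique hσ (hf σ hσ), hq'.unique hσ' (hf σ' hσ')]
  refine hher.eq_of_walls (fun ρ => eval x (iterPDeriv l (p ρ))) (Δ.nonempty_of_mem_faces hβ.1)
    hσ hσ' hβσ hβσ' fun τ hτ hβτ ρ hρ ρ' hρ' hρρ' => ?_
  have h2 := (Submodule.mem_inf.1 (h τ hτ ρ hρ ρ' hρ' hρρ')).2
  simp only [Submodule.mem_iInf] at h2
  have h3 := eval_iterPDeriv_eq_zero (h2 β ⟨hβ, hβτ⟩) hl hx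
  rw [iterPDeriv_sub, map_sub] at h3
  exact sub_eq_zero.1 h3

theorem AffineCriterion.mem_supersplineSpace (hfin : Δ.faces.Finite) (hpure : IsPure Δ)
    (hher : IsHereditary Δ) (hn : 0 < n) (hℓ : ∀ τ ∈ interiorWalls Δ, IsWallForm τ (ℓ τ))
    {d : ℕ} (hd : ∀ σ ∈ iFaces Δ n, (p σ).totalDegree ≤ d)
    (h : AffineCriterion Δ i r s ℓ p) {f : (Fin n → ℝ) → ℝ}
    (hf : ∀ σ ∈ iFaces Δ n, IsPiece f σ (p σ)) : f ∈ supersplineSpace Δ i r s := by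
  refine Set.mem_iUnion.2 ⟨d, ⟨⟨?_, fun σ hσ => ⟨p σ, hd σ hσ, hf σ hσ⟩⟩, fun τ hτ => ⟨?_, ?_⟩⟩,
    fun β hβ => h.isSupersmoothAt hher hf hβ⟩
  · rw [Nat.cast_zero, contDiffOn_zero]
    exact continuousOn_space_of_pieces hfin hpure hf
  · exact contDiffOn_faceStar_space hfin hpure hn hf hτ (hℓ τ hτ)
      fun σ hσ σ' hσ' hσσ' => h.dvd hτ hσ hσ' hσσ'
  · intro σ hσ
    have hσ := iFaces_faceStar_subset τ n hσ
    exact ⟨p σ, hd σ hσ, hf σ hσ⟩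

theorem HomogeneousCriterion.of_mem_supersplineSpace (hfin : Δ.faces.Finite) (hpure : IsPure Δ)
    (hℓ : ∀ τ ∈ interiorWalls Δ, IsWallForm τ (ℓ τ))
    {d : ℕ} (hd : ∀ σ ∈ iFaces Δ n, (p σ).totalDegree ≤ d) {f : (Fin n → ℝ) → ℝ}
    (hf : ∀ σ ∈ iFaces Δ n, IsPiece f σ (p σ)) (hfs : f ∈ supersplineSpace Δ i r s) :
    HomogeneousCriterion Δ i r s ℓ d p := by
  obtain ⟨d', ⟨-, hmixed⟩, hsuper⟩ := Set.mem_iUnion.1 hfs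
  intro τ hτ σ hσ σ' hσ' hσσ'
  have hτσ : τ ⊆ σ := by
    rw [← Finset.coe_subset, ← hσσ']
    exact Set.inter_subset_left
  have hτσ' : τ ⊆ σ' := by
    rw [← Finset.coe_subset, ← hσσ']
    exact Set.inter_subset_right
  have hdeg : (p σ - p σ').totalDegree ≤ d :=
    (totalDegree_sub _ _).trans (max_le (hd σ hσ) (hd σ' hσ'))
  rw [← homogenizeIn_sub]
  refine Submodule.mem_inf.2 ⟨?_, ?_⟩
  -- Here the face is the wall itself and the ideal is principal: every linear form vanishing on the
  -- cone of `τ` is a multiple of `ℓ τ`.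
  · rw [← Ideal.span_singleton_pow]
    refine homogenizeIn_mem_pow (Δ.nonempty_of_mem_faces hτ.1) hdeg (fun l hl x hx => ?_) _
      fun c hc => linearForm_mem_span_wallForm (Δ.indep hτ.1) hτ.2.1 (hℓ τ hτ) hc
    have hstar : ∀ ρ ∈ iFaces Δ n, τ ⊆ ρ → simplex ρ ⊆ (faceStar Δ τ).space :=
      fun ρ hρ hτρ y hy => (mem_faceStar_space_iff hfin hpure).2 ⟨ρ, hρ, hτρ, hy⟩
    have hpart : ∀ ρ ∈ iFaces Δ n, τ ⊆ ρ → _ := fun ρ hρ hτρ =>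
      eval_iterPDeriv_eq_iteratedFDerivWithin (uniqueDiffOn_faceStar_space hfin hpure τ)
        (uniqueDiffOn_simplex hρ) (hstar ρ hρ hτρ) (hmixed τ hτ).1 (hf ρ hρ)
        (simplex_mono hτρ hx) hl
    rw [iterPDeriv_sub, map_sub, hpart σ hσ hτσ, hpart σ' hσ' hτσ', sub_self]
  · simp only [Submodule.mem_iInf]
    rintro β ⟨hβ, hβτ⟩
    refine homogenizeIn_mem_pow (Δ.nonempty_of_mem_faces hβ.1) hdeg (fun l hl x hx => ?_) _
      fun c hc => linearForm_mem_faceIdealHom hc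
    rw [iterPDeriv_sub, map_sub, hsuper β hβ σ hσ σ' hσ' (hβτ.trans hτσ) (hβτ.trans hτσ')
      (p σ) (p σ') (hf σ hσ) (hf σ' hσ') l hl x hx, sub_self]

end Splines

theorem theorem3p3 {n : ℕ} (Δ : SimplicialComplex ℝ (Fin n → ℝ)) (hfin : Δ.faces.Finite)
    (hpure : IsPure Δ) (hher : IsHereditary Δ)
    (i : ℕ) (hi : i + 2 ≤ n)
    (r s : Finset (Fin n → ℝ) → ℕ)
    (ℓ : Finset (Fin n → ℝ) → MvPolynomial (Fin (n + 1)) ℝ)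
    (hℓ : ∀ τ ∈ interiorWalls Δ, IsWallForm τ (ℓ τ))
    (p : Finset (Fin n → ℝ) → MvPolynomial (Fin n) ℝ)
    (d : ℕ) (hd : ∀ σ ∈ iFaces Δ n, (p σ).totalDegree ≤ d) :
    (∀ f : (Fin n → ℝ) → ℝ, (∀ σ ∈ iFaces Δ n, IsPiece f σ (p σ)) →
      [f ∈ supersplineSpace Δ i r s,
        HomogeneousCriterion Δ i r s ℓ d p,
        AffineCriterion Δ i r s ℓ p].TFAE) ∧
    [(∃ f ∈ supersplineSpace Δ i r s, ∀ σ ∈ iFaces Δ n, IsPiece f σ (p σ)),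
      HomogeneousCriterion Δ i r s ℓ d p,
      AffineCriterion Δ i r s ℓ p].TFAE := by
  have hn : 0 < n := by omega
  refine ⟨fun f hf => ?_, ?_⟩
  · tfae_have 1 → 2 := HomogeneousCriterion.of_mem_supersplineSpace hfin hpure hℓ hd hf
    tfae_have 2 → 3 := AffineCriterion.of_homogeneousCriterion
    tfae_have 3 → 1 := fun h => h.mem_supersplineSpace hfin hpure hher hn hℓ hd hf
    tfae_finish
  · tfae_have 1 → 2 := fun ⟨f, hfs, hf⟩ =>
      HomogeneousCriterion.of_mem_supersplineSpace hfin hpure hℓ hd hf hfs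
    tfae_have 2 → 3 := AffineCriterion.of_homogeneousCriterion
    tfae_have 3 → 1 := fun h => by
      obtain ⟨f, hf⟩ := h.exists_function hher hℓ
      exact ⟨f, h.mem_supersplineSpace hfin hpure hher hn hℓ hd hf, hf⟩
    tfae_finish
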